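/- Let $\mathbb{T}^3=(\mathbb{R}/\mathbb{Z})^3$, $-3<\gamma<0$, and let $q_0$ be measurable with $0\le q_0(\theta)\le C|\cos\theta|$ for all $\theta\in[0,\pi]$ and some constant $C$. Put $B(v-u,\omega)=|v-u|^\gamma q_0(\theta)$ with $\cos\theta=(v-u)\cdot\omega/|v-u|$, and $$Q(G,F)(v)=\int_{\mathbb{R}^3}\int_{\mathbb{S}^2}B(v-u,\omega)G(u')F(v')\,d\omega\,du-\int_{\mathbb{R}^3}\int_{\mathbb{S}^2}B(v-u,\omega)G(u)F(v)\,d\omega\,du,$$ where $u'=u+[(v-u)\cdot\omega]\omega$ and $v'=v-[(v-u)\cdot\omega]\omega$. Let $\mu(v)=(2\pi)^{-3/2}e^{-|v|^2/2}$ and $$w(v,t)=(1+|v|^2)^{\beta}\exp\Big\{\frac q8\big(1+(1+t)^{-\vartheta}\big)|v|^2\Big\},\qquad \beta\ge\tfrac72,\quad 0<q<1,\quad 0\le\vartheta<-\frac2\gamma .$$ Write $\|\cdot\|_{L^\infty}$ for the norm of $L^\infty(\mathbb{T}^3\times\mathbb{R}^3)$. A mild solution on $[0,T]$ of the Boltzmann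 equation $\partial_tF+v\cdot\nabla_xF=Q(F,F)$ on $\mathbb{T}^3\times\mathbb{R}^3$ with $F(0,\cdot,\cdot)=F_0$ is a measurable function $F$ on $[0,T]\times\mathbb{T}^3\times\mathbb{R}^3$ such that for every $t\in[0,T]$ and almost every $(x,v)$ $$F(t,x,v)=F_0(x-tv,v)+\int_0^tQ(F,F)(s,x-(t-s)v,v)\,ds,$$ the time integral converging absolutely and, for every $t\in[0,T]$ and almost every $(x,v)$, the two integrals that define $Q(F,F)(t,x,v)$ converging absolutely. **Lemma.** Let $f_0$ be a measurable function on $\mathbb{T}^3\times\mathbb{R}^3$ with $F_0=\mu+\sqrt\mu f_0\ge0$ almost everywhere and $\|w(\cdot,0)f_0\|_{L^\infty}<\infty$. Then there are a time $\hat t_0>0$ and a mild solution $F=\mu+\sqrt\mu f$ on $[0,\hat t_0]$ of the Boltzmann equation with initial data $F_0$, nonnegative almost everywhere in $(x,v)$ at each time $t\in[0,\hat t_0]$, such that $$\sup_{0\le t\le\hat t_0}\|w(\cdot,t)f(t)\|_{L^\infty}\le2\|w(\cdot,0)f_0\|_{L^\infty}.$$ It is unique: if $G=\mu+\sqrt\mu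 g$ is a mild solution on $[0,\hat t_0]$ with the same initial data, nonnegative in the same sense, and $\sup_{0\le t\le\hat t_0}\|w(\cdot,t)g(t)\|_{L^\infty}<\infty$, then for every $t\in[0,\hat t_0]$, $g(t)=f(t)$ almost everywhere. -/

import Mathlib

open MeasureTheory Set
open scoped ENNReal

namespace Boltzmann

/-- The spatial domain `𝕋³ = (ℝ/ℤ)³`, with its Haar (Lebesgue) measure `dx`. -/
abbrev Torus : Type := Fin 3 → UnitAddCircle

/-- The velocity space `ℝ³`, with the Euclidean norm and Lebesgue measure `dv`. -/
abbrev Vel : Type := EuclideanSpace ℝ (Fin 3)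

/-- The unit sphere `𝕊²`. -/
abbrev Sph : Type := Metric.sphere (0 : Vel) 1

/-- The surface measure `dω` on `𝕊²` (of total mass `4π`). -/
noncomputable abbrev sphMeasure : Measure Sph := (volume : Measure Vel).toSphere

/-- The global Maxwellian `μ(v) = (2π)^(-3/2) exp(-|v|²/2)`. -/
noncomputable def maxwellian (v : Vel) : ℝ :=
  1 / (2 * Real.pi) ^ (3 / 2 : ℝ) * Real.exp (-‖v‖ ^ 2 / 2)

/-- The velocity `u' = u + [(v - u) · ω] ω`. -/
noncomputable def uPost (v u : Vel) (ω : Sph) : Vel :=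
  u + (inner ℝ (v - u) (ω : Vel)) • (ω : Vel)

/-- The velocity `v' = v - [(v - u) · ω] ω`. -/
noncomputable def vPost (v u : Vel) (ω : Sph) : Vel :=
  v - (inner ℝ (v - u) (ω : Vel)) • (ω : Vel)

/-- The collision kernel `B(v - u, ω) = |v - u|^γ q₀(θ)`, where `θ ∈ [0, π]` is the angle between
the relative velocity `z = v - u` and `ω`, that is `cos θ = z · ω / |z|`. -/
noncomputable def kernelB (γ : ℝ) (q₀ : ℝ → ℝ) (z : Vel) (ω : Sph) : ℝ :=
  ‖z‖ ^ γ * q₀ (InnerProductGeometry.angle z (ω : Vel))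

/-- The integrand `B(v - u, ω) G(u') F(v')` of the gain term, as a function of `(u, ω)`. -/
noncomputable def gainIntegrand (γ : ℝ) (q₀ : ℝ → ℝ) (G F : Vel → ℝ) (v : Vel) (p : Vel × Sph) :
    ℝ :=
  kernelB γ q₀ (v - p.1) p.2 * G (uPost v p.1 p.2) * F (vPost v p.1 p.2)

/-- The integrand `B(v - u, ω) G(u) F(v)` of the loss term, as a function of `(u, ω)`. -/
noncomputable def lossIntegrand (γ : ℝ) (q₀ : ℝ → ℝ) (G F : Vel → ℝ) (v : Vel) (p : Vel × Sph) :
    ℝ :=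
  kernelB γ q₀ (v - p.1) p.2 * G p.1 * F v

/-- The gain term `Q₊(G, F)(v) = ∫_{ℝ³ × 𝕊²} B(v - u, ω) G(u') F(v') dω du`. -/
noncomputable def gain (γ : ℝ) (q₀ : ℝ → ℝ) (G F : Vel → ℝ) (v : Vel) : ℝ :=
  ∫ p, gainIntegrand γ q₀ G F v p ∂((volume : Measure Vel).prod sphMeasure)

/-- The loss term `Q₋(G, F)(v) = ∫_{ℝ³ × 𝕊²} B(v - u, ω) G(u) F(v) dω du`. -/
noncomputable def loss (γ : ℝ) (q₀ : ℝ → ℝ) (G F : Vel → ℝ) (v : Vel) : ℝ :=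
  ∫ p, lossIntegrand γ q₀ G F v p ∂((volume : Measure Vel).prod sphMeasure)

/-- The Boltzmann collision operator `Q(G, F) = Q₊(G, F) - Q₋(G, F)`. -/
noncomputable def collision (γ : ℝ) (q₀ : ℝ → ℝ) (G F : Vel → ℝ) (v : Vel) : ℝ :=
  gain γ q₀ G F v - loss γ q₀ G F v

/-- The point `x - r v` of the torus. -/
noncomputable def backward (x : Torus) (r : ℝ) (v : Vel) : Torus :=
  fun i => x i - ((r * v i : ℝ) : UnitAddCircle)

/-- `F` is a mild solution on `[0, T]` of
`∂ₜF + v · ∇ₓF = Q(F, F)`, `F(0, ·, ·) = F₀`, on `𝕋³ × ℝ³`: the equation integrated along the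
characteristics `s ↦ (x - (t - s) v, v)`, at every time `t` and for almost every `(x, v)`.
All integrals involved are required to converge absolutely. -/
structure IsMildSolution (γ : ℝ) (q₀ : ℝ → ℝ) (F₀ : Torus × Vel → ℝ) (T : ℝ)
    (F : ℝ → Torus × Vel → ℝ) : Prop where
  measurable : Measurable fun p : Icc (0 : ℝ) T × (Torus × Vel) => F p.1 p.2
  integrable_gain : ∀ t ∈ Icc (0 : ℝ) T, ∀ᵐ z : Torus × Vel,
    Integrable (gainIntegrand γ q₀ (fun v => F t (z.1, v)) (fun v => F t (z.1, v)) z.2)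
      ((volume : Measure Vel).prod sphMeasure)
  integrable_loss : ∀ t ∈ Icc (0 : ℝ) T, ∀ᵐ z : Torus × Vel,
    Integrable (lossIntegrand γ q₀ (fun v => F t (z.1, v)) (fun v => F t (z.1, v)) z.2)
      ((volume : Measure Vel).prod sphMeasure)
  integrable_collision : ∀ t ∈ Icc (0 : ℝ) T, ∀ᵐ z : Torus × Vel,
    IntervalIntegrable
      (fun s => collision γ q₀ (fun v => F s (backward z.1 (t - s) z.2, v))
        (fun v => F s (backward z.1 (t - s) z.2, v)) z.2) volume 0 t
  equation : ∀ t ∈ Icc (0 : ℝ) T, ∀ᵐ z : Torus × Vel,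
    F t z = F₀ (backward z.1 t z.2, z.2) +
      ∫ s in (0 : ℝ)..t, collision γ q₀ (fun v => F s (backward z.1 (t - s) z.2, v))
        (fun v => F s (backward z.1 (t - s) z.2, v)) z.2

/-- A mild solution on `[0, T]` that is nonnegative at every time. -/
structure IsNonnegSolution (γ : ℝ) (q₀ : ℝ → ℝ) (F₀ : Torus × Vel → ℝ) (T : ℝ)
    (F : ℝ → Torus × Vel → ℝ) : Prop extends IsMildSolution γ q₀ F₀ T F where
  nonneg : ∀ t ∈ Icc (0 : ℝ) T, ∀ᵐ z : Torus × Vel, 0 ≤ F t z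

/-- The function `μ + √μ f` of `(x, v)`. -/
noncomputable def perturbed (f : Torus × Vel → ℝ) (z : Torus × Vel) : ℝ :=
  maxwellian z.2 + Real.sqrt (maxwellian z.2) * f z

/-- The time-dependent velocity weight
`w(v, t) = (1 + |v|²)^β exp((q/8) (1 + (1 + t)^(-ϑ)) |v|²)`. -/
noncomputable def weight (q ϑ β : ℝ) (t : ℝ) (v : Vel) : ℝ :=
  (1 + ‖v‖ ^ 2) ^ β * Real.exp (q / 8 * (1 + (1 + t) ^ (-ϑ)) * ‖v‖ ^ 2)

/-- The function `w(·, t) f` of `(x, v)`. -/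
noncomputable def weighted (q ϑ β : ℝ) (t : ℝ) (f : Torus × Vel → ℝ) (z : Torus × Vel) : ℝ :=
  weight q ϑ β t z.2 * f z

/-- The norm `‖w(·, t) f‖` in `L^∞(𝕋³ × ℝ³)` (essential supremum), with values in `[0, ∞]`. -/
noncomputable def weightedNorm (q ϑ β : ℝ) (t : ℝ) (f : Torus × Vel → ℝ) : ℝ≥0∞ :=
  eLpNorm (weighted q ϑ β t f) ∞ volume

end Boltzmann

/-! For a soft potential the collision term is locally Lipschitz in the weighted space, with no loss
of weight, so a fixed-point argument suffices. Write ρ_t = √μ / w(·, t). As γ < 0 and γ > -3,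
`exists_kernelBound` gives ∫ B(v - u, ω) √μ(u) dω du ≤ C uniformly in v. Conservation of energy
gives ρ_t(u') ρ_t(v') ≤ √μ(u) ρ_t(v) (`envelope_mul_post_le`), and ρ_t(u) ≤ √μ(u) because w ≥ 1. If
two functions are at most A ρ_t and differ by at most d ρ_t, their gain and loss terms therefore
differ by at most 4 C A d ρ_t in all (`KernelBound.abs_splitCollision_sub_le`). Since ρ_t increases
with t and v is constant along characteristics, integration in time preserves such bounds. Finally μ
≤ D ρ_t because q < 1, so μ + √μ f is itself bounded by a multiple of ρ_t.

To obtain nonnegativity, Picard iteration is applied to the relaxed collision term Q₊(|F|, |F|) -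
Q₋(|F|, F). On a short interval the map halves distances; since Q(μ, μ) = 0, the ball of radius 2M
about μ is preserved, M being the norm of the initial perturbation. Where F ≤ 0 the relaxed term is
nonnegative, so along a characteristic F cannot become negative; then |F| = F and the original
equation holds.

For uniqueness, iterating the Lipschitz bound along the Duhamel formula produces (4CAt)^n / n!,
which tends to 0 for every t, however large the bound on the competitor. The competitor is
controlled only almost everywhere, so null sets must pull back to null sets under the collision maps
and transport. -/

namespace Boltzmann

open Filter Topology

/-! ### The collision kernel -/

/-- The properties of the collision kernel `B = |v - u|^γ q₀(θ)` that the local theory uses: it is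
measurable and nonnegative, and `∫ B(v - u, ω) √μ(u) dω du ≤ C` for all `v`. -/
structure KernelBound (γ : ℝ) (q₀ : ℝ → ℝ) (C : ℝ) : Prop where
  measurable : Measurable fun p : Vel × Sph => kernelB γ q₀ p.1 p.2
  nonneg : ∀ z ω, 0 ≤ kernelB γ q₀ z ω
  integrable : ∀ v, Integrable
    (fun p : Vel × Sph => kernelB γ q₀ (v - p.1) p.2 * √(maxwellian p.1))
    ((volume : Measure Vel).prod sphMeasure)
  integral_le : ∀ v, ∫ p : Vel × Sph, kernelB γ q₀ (v - p.1) p.2 * √(maxwellian p.1)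
    ∂((volume : Measure Vel).prod sphMeasure) ≤ C

theorem maxwellian_pos (v : Vel) : 0 < maxwellian v := by
  unfold maxwellian; positivity

theorem measurable_maxwellian : Measurable maxwellian := by
  unfold maxwellian; fun_prop

/-- The normalizing constant of `√μ`. -/
noncomputable def sqrtConst : ℝ := √(1 / (2 * Real.pi) ^ (3 / 2 : ℝ))

theorem sqrtConst_le_one : sqrtConst ≤ 1 := by
  unfold sqrtConst
  refine Real.sqrt_le_one.2 ?_
  have h : (1 : ℝ) ≤ (2 * Real.pi) ^ (3 / 2 : ℝ) :=
    Real.one_le_rpow (by linarith [Real.pi_gt_three]) (by norm_num)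
  exact div_le_one_of_le₀ h (by positivity)

theorem sqrt_maxwellian (v : Vel) :
    √(maxwellian v) = sqrtConst * Real.exp (-‖v‖ ^ 2 / 4) := by
  unfold maxwellian sqrtConst
  rw [Real.sqrt_mul (by positivity)]
  congr 1
  rw [Real.sqrt_eq_iff_mul_self_eq (Real.exp_pos _).le (Real.exp_pos _).le, ← Real.exp_add]
  congr 1
  ring

theorem sqrt_maxwellian_le_one (v : Vel) : √(maxwellian v) ≤ 1 := by
  rw [sqrt_maxwellian]
  exact mul_le_one₀ sqrtConst_le_one (Real.exp_pos _).le
    (Real.exp_le_one_iff.2 (by have := sq_nonneg ‖v‖; linarith))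

theorem integrable_sqrt_maxwellian : Integrable fun v : Vel => √(maxwellian v) := by
  -- With zero linear term, the modulus of the complex Gaussian is the real Gaussian exp(-|v|²/4).
  have h := (GaussianFourier.integrable_cexp_neg_mul_sq_norm_add (V := Vel) (b := 1 / 4)
    (by norm_num) 0 0).norm
  have h' : Integrable fun v : Vel => sqrtConst * Real.exp (-‖v‖ ^ 2 / 4) := by
    refine Integrable.const_mul (h.congr (Filter.Eventually.of_forall fun v => ?_)) _
    simp only [Complex.norm_exp]
    congr 1
    have : -(1 / 4 : ℂ) * (‖v‖ : ℂ) ^ 2 + 0 * ((inner ℝ (0 : Vel) v : ℝ) : ℂ)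
        = ((-‖v‖ ^ 2 / 4 : ℝ) : ℂ) := by push_cast; ring
    rw [this, Complex.ofReal_re]
  simpa only [sqrt_maxwellian] using h'

/-- The singular part of `|z|^γ`. -/
noncomputable def singularPart (γ : ℝ) (r : ℝ) : ℝ := if r ≤ 1 then r ^ γ else 0

/-- In polar coordinates the radial integrand is r^(γ + 2) on (0, 1], and γ + 2 > -1. -/
theorem integrable_singularPart {γ : ℝ} (hγ : -3 < γ) :
    Integrable fun z : Vel => singularPart γ ‖z‖ := by
  rw [integrable_fun_norm_addHaar (volume : Measure Vel) (f := singularPart γ)]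
  have hd : Module.finrank ℝ Vel = 3 := by simp
  rw [hd]
  have h1 : IntegrableOn (fun y : ℝ => y ^ (γ + 2)) (Ioc 0 1) := by
    have := (intervalIntegral.intervalIntegrable_rpow' (a := 0) (b := 1)
      (show -1 < γ + 2 by linarith))
    rwa [intervalIntegrable_iff_integrableOn_Ioc_of_le zero_le_one] at this
  have h2 : IntegrableOn ((Ioc (0 : ℝ) 1).indicator fun y : ℝ => y ^ (γ + 2)) (Ioi 0) :=
    ((integrable_indicator_iff measurableSet_Ioc).2 h1).integrableOn
  refine h2.congr_fun (fun y hy => ?_) measurableSet_Ioi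
  have hy' : 0 < y := hy
  by_cases hy1 : y ≤ 1
  · simp only [indicator, mem_Ioc, hy', hy1, and_self, if_true, singularPart, smul_eq_mul]
    rw [Real.rpow_add hy', mul_comm]
    norm_num
  · simp [indicator, hy1, singularPart]

/-- Inside the unit ball m ≤ 1 is dropped; outside it |z|^γ ≤ 1 is dropped. -/
theorem rpow_norm_mul_le {γ : ℝ} (hγ : γ < 0) (z : Vel) {m : ℝ} (hm : 0 ≤ m) (hm1 : m ≤ 1) :
    ‖z‖ ^ γ * m ≤ singularPart γ ‖z‖ + m := by
  unfold singularPart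
  have h0 : 0 ≤ ‖z‖ ^ γ := by positivity
  split_ifs with h
  · nlinarith
  · have : ‖z‖ ^ γ ≤ 1 := Real.rpow_le_one_of_one_le_of_nonpos (le_of_not_ge h) hγ.le
    nlinarith

theorem measurable_kernelB {γ : ℝ} {q₀ : ℝ → ℝ} (hq₀ : Measurable q₀) :
    Measurable fun p : Vel × Sph => kernelB γ q₀ p.1 p.2 := by
  unfold kernelB InnerProductGeometry.angle
  refine Measurable.mul (by fun_prop) (hq₀.comp (Real.continuous_arccos.measurable.comp ?_))
  refine Measurable.div ?_ ?_
  · exact measurable_fst.inner (measurable_subtype_coe.comp measurable_snd)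
  · fun_prop

/-- As B ≤ C|v - u|^γ, splitting at |v - u| = 1 leaves the singular part and √μ, each integrable in
u. Translation invariance makes the integral of the first independent of v. -/
theorem exists_kernelBound {γ : ℝ} (hγ : -3 < γ) (hγ' : γ < 0) {q₀ : ℝ → ℝ}
    (hq₀_meas : Measurable q₀)
    (hq₀ : ∃ C : ℝ, ∀ θ ∈ Icc (0 : ℝ) Real.pi, 0 ≤ q₀ θ ∧ q₀ θ ≤ C * |Real.cos θ|) :
    ∃ C, KernelBound γ q₀ C := by
  obtain ⟨C, hC⟩ := hq₀
  have hC0 : 0 ≤ C := by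
    have := hC 0 ⟨le_rfl, Real.pi_pos.le⟩
    simp only [Real.cos_zero, abs_one, mul_one] at this
    linarith
  have hang : ∀ z ω : Vel, InnerProductGeometry.angle z ω ∈ Icc (0 : ℝ) Real.pi := fun z ω =>
    ⟨InnerProductGeometry.angle_nonneg _ _, InnerProductGeometry.angle_le_pi _ _⟩
  have hnn : ∀ z ω, 0 ≤ kernelB γ q₀ z ω := fun z ω =>
    mul_nonneg (by positivity) (hC _ (hang z ω)).1
  have hle : ∀ z ω, kernelB γ q₀ z ω ≤ ‖z‖ ^ γ * C := fun z ω => by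
    refine mul_le_mul_of_nonneg_left ((hC _ (hang z ω)).2.trans ?_) (by positivity)
    exact mul_le_of_le_one_right hC0 (Real.abs_cos_le_one _)
  have hmeas := measurable_kernelB (γ := γ) hq₀_meas
  have hmeas' : ∀ v, Measurable
      fun p : Vel × Sph => kernelB γ q₀ (v - p.1) p.2 * √(maxwellian p.1) := fun v =>
    (hmeas.comp ((measurable_const.sub measurable_fst).prodMk measurable_snd)).mul
      (measurable_maxwellian.comp measurable_fst).sqrt
  have hs : ∀ v : Vel, Integrable fun u : Vel => singularPart γ ‖v - u‖ := fun v =>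
    (integrable_singularPart hγ).comp_sub_left v
  have hdom : ∀ v : Vel, Integrable
      (fun u : Vel => C * (singularPart γ ‖v - u‖ + √(maxwellian u))) := fun v =>
    ((hs v).add integrable_sqrt_maxwellian).const_mul C
  have hdom' : ∀ v : Vel, Integrable
      (fun p : Vel × Sph => C * (singularPart γ ‖v - p.1‖ + √(maxwellian p.1)))
      ((volume : Measure Vel).prod sphMeasure) := fun v => (hdom v).comp_fst _
  have hbd : ∀ (v : Vel) (p : Vel × Sph), kernelB γ q₀ (v - p.1) p.2 * √(maxwellian p.1) ≤
      C * (singularPart γ ‖v - p.1‖ + √(maxwellian p.1)) := fun v p => by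
    have h1 := rpow_norm_mul_le hγ' (v - p.1) (Real.sqrt_nonneg (maxwellian p.1))
      (sqrt_maxwellian_le_one p.1)
    calc _ ≤ ‖v - p.1‖ ^ γ * C * √(maxwellian p.1) :=
          mul_le_mul_of_nonneg_right (hle _ _) (Real.sqrt_nonneg _)
      _ = C * (‖v - p.1‖ ^ γ * √(maxwellian p.1)) := by ring
      _ ≤ _ := mul_le_mul_of_nonneg_left h1 hC0
  have hint : ∀ v, Integrable
      (fun p : Vel × Sph => kernelB γ q₀ (v - p.1) p.2 * √(maxwellian p.1))
      ((volume : Measure Vel).prod sphMeasure) := fun v => by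
    refine (hdom' v).mono' (hmeas' v).aestronglyMeasurable (Filter.Eventually.of_forall fun p => ?_)
    rw [Real.norm_of_nonneg (mul_nonneg (hnn _ _) (Real.sqrt_nonneg _))]
    exact hbd v p
  refine ⟨sphMeasure.real univ * (C * ((∫ z : Vel, singularPart γ ‖z‖) +
    ∫ u : Vel, √(maxwellian u))), hmeas, hnn, hint, fun v => ?_⟩
  refine (integral_mono (hint v) (hdom' v) (hbd v)).trans_eq ?_
  rw [integral_fun_fst (μ := (volume : Measure Vel)) (ν := sphMeasure)
    (fun u : Vel => C * (singularPart γ ‖v - u‖ + √(maxwellian u)))]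
  rw [smul_eq_mul, integral_const_mul, integral_add (hs v) integrable_sqrt_maxwellian,
    integral_sub_left_eq_self (fun z : Vel => singularPart γ ‖z‖)]

/-! ### The envelope `√μ / w` -/

/-- The function `√μ / w(·, t)`, which bounds `√μ f` when `‖w(·, t) f‖ ≤ 1`. -/
noncomputable def envelope (q ϑ β t : ℝ) (v : Vel) : ℝ :=
  √(maxwellian v) / weight q ϑ β t v

theorem weight_pos (q ϑ β t : ℝ) (v : Vel) : 0 < weight q ϑ β t v := by
  unfold weight; positivity

theorem envelope_pos (q ϑ β t : ℝ) (v : Vel) : 0 < envelope q ϑ β t v :=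
  div_pos (Real.sqrt_pos.2 (maxwellian_pos v)) (weight_pos ..)

theorem measurable_weight (q ϑ β t : ℝ) : Measurable (weight q ϑ β t) := by
  unfold weight; fun_prop

theorem measurable_envelope (q ϑ β t : ℝ) : Measurable (envelope q ϑ β t) :=
  measurable_maxwellian.sqrt.div (measurable_weight ..)

theorem weight_anti {q ϑ β : ℝ} (hq : 0 < q) (hϑ : 0 ≤ ϑ) {s t : ℝ} (hs : 0 ≤ s) (hst : s ≤ t)
    (v : Vel) : weight q ϑ β t v ≤ weight q ϑ β s v := by
  unfold weight
  have h : (1 + t) ^ (-ϑ) ≤ (1 + s) ^ (-ϑ) :=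
    Real.rpow_le_rpow_of_nonpos (by linarith) (by linarith) (by linarith)
  gcongr

/-- This lets bounds at earlier times on a characteristic be replaced by bounds at its endpoint. -/
theorem envelope_mono {q ϑ β : ℝ} (hq : 0 < q) (hϑ : 0 ≤ ϑ) {s t : ℝ} (hs : 0 ≤ s) (hst : s ≤ t)
    (v : Vel) : envelope q ϑ β s v ≤ envelope q ϑ β t v :=
  div_le_div_of_nonneg_left (Real.sqrt_nonneg _) (weight_pos ..) (weight_anti hq hϑ hs hst v)

theorem one_le_weight {q ϑ β : ℝ} (hq : 0 < q) (hβ : 0 ≤ β) {t : ℝ} (ht : 0 ≤ t) (v : Vel) :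
    1 ≤ weight q ϑ β t v := by
  unfold weight
  have h1 : 1 ≤ (1 + ‖v‖ ^ 2) ^ β := Real.one_le_rpow (by have := sq_nonneg ‖v‖; linarith) hβ
  have h2 : 1 ≤ Real.exp (q / 8 * (1 + (1 + t) ^ (-ϑ)) * ‖v‖ ^ 2) :=
    Real.one_le_exp (by positivity)
  exact one_le_mul_of_one_le_of_one_le h1 h2

theorem envelope_le {q ϑ β : ℝ} (hq : 0 < q) (hβ : 0 ≤ β) {t : ℝ} (ht : 0 ≤ t) (v : Vel) :
    envelope q ϑ β t v ≤ √(maxwellian v) :=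
  div_le_self (Real.sqrt_nonneg _) (one_le_weight hq hβ ht v)

theorem norm_post_sq (v u : Vel) (ω : Sph) :
    ‖uPost v u ω‖ ^ 2 + ‖vPost v u ω‖ ^ 2 = ‖u‖ ^ 2 + ‖v‖ ^ 2 := by
  have hω : ‖(ω : Vel)‖ = 1 := by simp
  unfold uPost vPost
  rw [norm_add_sq_real, norm_sub_sq_real, norm_smul, inner_smul_right, inner_smul_right, hω,
    inner_sub_left]
  simp only [Real.norm_eq_abs, mul_one, sq_abs]
  ring

theorem sqrt_maxwellian_post (v u : Vel) (ω : Sph) :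
    √(maxwellian (uPost v u ω)) * √(maxwellian (vPost v u ω)) =
      √(maxwellian u) * √(maxwellian v) := by
  simp only [sqrt_maxwellian]
  have h : ∀ a b : ℝ, sqrtConst * Real.exp a * (sqrtConst * Real.exp b) =
      sqrtConst * sqrtConst * Real.exp (a + b) := fun a b => by rw [Real.exp_add]; ring
  rw [h, h]
  congr 2
  linarith [norm_post_sq v u ω]

theorem maxwellian_post (v u : Vel) (ω : Sph) :
    maxwellian (uPost v u ω) * maxwellian (vPost v u ω) = maxwellian u * maxwellian v := by
  have h := congrArg (· ^ 2) (sqrt_maxwellian_post v u ω)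
  simpa only [mul_pow, Real.sq_sqrt (maxwellian_pos _).le] using h

theorem weight_le_mul_post {q ϑ β : ℝ} (hq : 0 < q) (hβ : 0 ≤ β) {t : ℝ} (ht : 0 ≤ t)
    (v u : Vel) (ω : Sph) :
    weight q ϑ β t v ≤ weight q ϑ β t (uPost v u ω) * weight q ϑ β t (vPost v u ω) := by
  have h := norm_post_sq v u ω
  unfold weight
  rw [mul_mul_mul_comm, ← Real.exp_add, ← Real.mul_rpow (by positivity) (by positivity), ← mul_add]
  have h1 : ‖v‖ ^ 2 ≤ ‖uPost v u ω‖ ^ 2 + ‖vPost v u ω‖ ^ 2 := by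
    have := sq_nonneg ‖u‖; linarith
  have h2 : 1 + ‖v‖ ^ 2 ≤ (1 + ‖uPost v u ω‖ ^ 2) * (1 + ‖vPost v u ω‖ ^ 2) := by
    have := mul_nonneg (sq_nonneg ‖uPost v u ω‖) (sq_nonneg ‖vPost v u ω‖); linarith
  gcongr

/-- Energy conservation acts twice: it makes the product of the two values of √μ invariant, and it
gives |v|² ≤ |u'|² + |v'|², hence w(v) ≤ w(u') w(v'). -/
theorem envelope_mul_post_le {q ϑ β : ℝ} (hq : 0 < q) (hβ : 0 ≤ β) {t : ℝ} (ht : 0 ≤ t)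
    (v u : Vel) (ω : Sph) :
    envelope q ϑ β t (uPost v u ω) * envelope q ϑ β t (vPost v u ω) ≤
      √(maxwellian u) * envelope q ϑ β t v := by
  unfold envelope
  rw [div_mul_div_comm, sqrt_maxwellian_post, ← mul_div_assoc]
  exact div_le_div_of_nonneg_left (by positivity) (weight_pos ..) (weight_le_mul_post hq hβ ht v u ω)

/-- This is y ≤ exp y at y = a(1 + x)/β, raised to the power β. -/
theorem one_add_rpow_le_exp {β a : ℝ} (hβ : 0 < β) (ha : 0 < a) {x : ℝ} (hx : 0 ≤ x) :
    (1 + x) ^ β ≤ (β / a) ^ β * Real.exp a * Real.exp (a * x) := by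
  have h1 : 1 + x ≤ β / a * Real.exp (a * (1 + x) / β) := by
    have h := Real.add_one_le_exp (a * (1 + x) / β)
    calc 1 + x = β / a * (a * (1 + x) / β) := by field_simp
      _ ≤ _ := mul_le_mul_of_nonneg_left (by linarith) (by positivity)
  calc (1 + x) ^ β ≤ (β / a * Real.exp (a * (1 + x) / β)) ^ β :=
        Real.rpow_le_rpow (by linarith) h1 hβ.le
    _ = (β / a) ^ β * Real.exp (a * (1 + x)) := by
        rw [Real.mul_rpow (by positivity) (by positivity), ← Real.exp_mul]
        congr 2
        field_simp
    _ = _ := by rw [mul_assoc, ← Real.exp_add]; congr 2; ring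

theorem exists_maxwellian_le {q ϑ β : ℝ} (hq : 0 < q) (hq' : q < 1) (hϑ : 0 ≤ ϑ) (hβ : 0 < β) :
    ∃ C, 0 ≤ C ∧ ∀ t, 0 ≤ t → ∀ v : Vel, maxwellian v ≤ C * envelope q ϑ β t v := by
  -- At t = 0 the envelope is smallest and the weight has exponent q/4, so √μ w decays like (1 +
  -- |v|²)^β exp(-a|v|²) with this `a`.
  set a := (1 - q) / 4 with ha
  have ha0 : 0 < a := by rw [ha]; linarith
  refine ⟨(β / a) ^ β * Real.exp a, by positivity, fun t ht v => ?_⟩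
  refine le_trans ?_ (mul_le_mul_of_nonneg_left (envelope_mono hq hϑ le_rfl ht v) (by positivity))
  unfold envelope
  rw [← mul_div_assoc, le_div_iff₀ (weight_pos ..)]
  have hs : maxwellian v = √(maxwellian v) * √(maxwellian v) :=
    (Real.mul_self_sqrt (maxwellian_pos v).le).symm
  conv_lhs => rw [hs]
  rw [mul_right_comm]
  refine mul_le_mul_of_nonneg_right ?_ (Real.sqrt_nonneg _)
  unfold weight
  rw [sqrt_maxwellian]
  have hx := one_add_rpow_le_exp hβ ha0 (sq_nonneg ‖v‖)
  have he : Real.exp (a * ‖v‖ ^ 2) * (Real.exp (-‖v‖ ^ 2 / 4) *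
      Real.exp (q / 8 * (1 + (1 + 0) ^ (-ϑ)) * ‖v‖ ^ 2)) = 1 := by
    rw [← Real.exp_add, ← Real.exp_add, Real.exp_eq_one_iff, ha, add_zero, Real.one_rpow]
    ring
  calc _ = sqrtConst * (1 + ‖v‖ ^ 2) ^ β * (Real.exp (-‖v‖ ^ 2 / 4) *
      Real.exp (q / 8 * (1 + (1 + 0) ^ (-ϑ)) * ‖v‖ ^ 2)) := by ring
    _ ≤ 1 * ((β / a) ^ β * Real.exp a * Real.exp (a * ‖v‖ ^ 2)) * (Real.exp (-‖v‖ ^ 2 / 4) *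
      Real.exp (q / 8 * (1 + (1 + 0) ^ (-ϑ)) * ‖v‖ ^ 2)) := by
        gcongr
        exact sqrtConst_le_one
    _ = _ := by rw [one_mul, mul_assoc _ (Real.exp _) (_ * _), he, mul_one]

instance : SFinite ((volume : Measure Vel).prod sphMeasure) := Measure.prod.instSFinite

instance : SFinite ((volume : Measure Vel).prod ((volume : Measure Vel).prod sphMeasure)) :=
  Measure.prod.instSFinite

/-! ### Estimates of the collision operator at a fixed velocity -/

/-- `F₁` and `F₂` are bounded by `A ρ` at `v`, and their difference by `d ρ`. -/
def CloseAt (ρ : Vel → ℝ) (A d : ℝ) (F₁ F₂ : Vel → ℝ) (v : Vel) : Prop :=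
  |F₁ v| ≤ A * ρ v ∧ |F₂ v| ≤ A * ρ v ∧ |F₁ v - F₂ v| ≤ d * ρ v

theorem CloseAt.abs {ρ : Vel → ℝ} {A d : ℝ} {F₁ F₂ : Vel → ℝ} {v : Vel}
    (h : CloseAt ρ A d F₁ F₂ v) : CloseAt ρ A d (fun v => |F₁ v|) (fun v => |F₂ v|) v :=
  ⟨by simpa using h.1, by simpa using h.2.1, (abs_abs_sub_abs_le _ _).trans h.2.2⟩

theorem abs_mul_sub_mul_le {x₁ x₂ y₁ y₂ A d r s : ℝ} (hx₂ : |x₂| ≤ A * r)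
    (hx : |x₁ - x₂| ≤ d * r) (hy₁ : |y₁| ≤ A * s) (hy : |y₁ - y₂| ≤ d * s) :
    |x₁ * y₁ - x₂ * y₂| ≤ 2 * A * d * (r * s) := by
  have h1 : x₁ * y₁ - x₂ * y₂ = (x₁ - x₂) * y₁ + x₂ * (y₁ - y₂) := by ring
  have h2 := mul_le_mul hx hy₁ (abs_nonneg _) ((abs_nonneg _).trans hx)
  have h3 := mul_le_mul hx₂ hy (abs_nonneg _) ((abs_nonneg _).trans hx₂)
  rw [h1]
  refine (abs_add_le _ _).trans ?_
  rw [abs_mul, abs_mul]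
  linarith

section

variable {γ : ℝ} {q₀ : ℝ → ℝ} {C : ℝ}

theorem KernelBound.constant_nonneg (hK : KernelBound γ q₀ C) : 0 ≤ C :=
  (integral_nonneg fun p : Vel × Sph => mul_nonneg (hK.nonneg (0 - p.1) p.2)
    (Real.sqrt_nonneg (maxwellian p.1))).trans (hK.integral_le 0)

theorem KernelBound.integrable_of_le (hK : KernelBound γ q₀ C) {v : Vel} {M : ℝ}
    {h : Vel × Sph → ℝ} (hm : Measurable h)
    (hle : ∀ᵐ p ∂((volume : Measure Vel).prod sphMeasure),
      |h p| ≤ M * (kernelB γ q₀ (v - p.1) p.2 * √(maxwellian p.1))) :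
    Integrable h ((volume : Measure Vel).prod sphMeasure) :=
  ((hK.integrable v).const_mul M).mono' hm.aestronglyMeasurable hle

theorem KernelBound.abs_integral_le (hK : KernelBound γ q₀ C) {v : Vel} {M : ℝ} (hM : 0 ≤ M)
    {h : Vel × Sph → ℝ}
    (hle : ∀ᵐ p ∂((volume : Measure Vel).prod sphMeasure),
      |h p| ≤ M * (kernelB γ q₀ (v - p.1) p.2 * √(maxwellian p.1))) :
    |∫ p, h p ∂((volume : Measure Vel).prod sphMeasure)| ≤ M * C := by
  refine (norm_integral_le_of_norm_le (f := h) ((hK.integrable v).const_mul M) hle).trans ?_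
  rw [integral_const_mul]
  exact mul_le_mul_of_nonneg_left (hK.integral_le v) hM

theorem continuous_uPost : Continuous fun p : Vel × (Vel × Sph) => uPost p.1 p.2.1 p.2.2 := by
  unfold uPost; fun_prop

theorem continuous_vPost : Continuous fun p : Vel × (Vel × Sph) => vPost p.1 p.2.1 p.2.2 := by
  unfold vPost; fun_prop

theorem KernelBound.measurable_kernel (hK : KernelBound γ q₀ C) :
    Measurable fun p : Vel × (Vel × Sph) => kernelB γ q₀ (p.1 - p.2.1) p.2.2 := by
  have h : Measurable fun p : Vel × (Vel × Sph) => (p.1 - p.2.1, p.2.2) := by fun_prop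
  have h' := hK.measurable.comp h
  exact h'

theorem KernelBound.measurable_gainIntegrand (hK : KernelBound γ q₀ C) {G F : Vel → ℝ}
    (hG : Measurable G) (hF : Measurable F) (v : Vel) :
    Measurable (gainIntegrand γ q₀ G F v) :=
  ((hK.measurable_kernel.comp measurable_prodMk_left).mul
    (hG.comp (continuous_uPost.measurable.comp measurable_prodMk_left))).mul
    (hF.comp (continuous_vPost.measurable.comp measurable_prodMk_left))

theorem KernelBound.measurable_lossIntegrand (hK : KernelBound γ q₀ C) {G F : Vel → ℝ}
    (hG : Measurable G) (v : Vel) :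
    Measurable (lossIntegrand γ q₀ G F v) :=
  ((hK.measurable_kernel.comp measurable_prodMk_left).mul (hG.comp measurable_fst)).mul_const _

/-- The compatibility of a majorant `ρ` with collisions. -/
structure CollisionBound (ρ : Vel → ℝ) : Prop where
  nonneg : ∀ v, 0 ≤ ρ v
  le_sqrt : ∀ v, ρ v ≤ √(maxwellian v)
  post_le : ∀ v u ω, ρ (uPost v u ω) * ρ (vPost v u ω) ≤ √(maxwellian u) * ρ v

variable {ρ : Vel → ℝ} {A d : ℝ} {G₁ G₂ F₁ F₂ : Vel → ℝ} {v : Vel}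

theorem KernelBound.abs_gainIntegrand_sub_le (hK : KernelBound γ q₀ C) (hρ : CollisionBound ρ)
    (hA : 0 ≤ A) (hd : 0 ≤ d) {p : Vel × Sph} (hu : CloseAt ρ A d G₁ G₂ (uPost v p.1 p.2))
    (hv : CloseAt ρ A d F₁ F₂ (vPost v p.1 p.2)) :
    |gainIntegrand γ q₀ G₁ F₁ v p - gainIntegrand γ q₀ G₂ F₂ v p| ≤
      2 * A * d * ρ v * (kernelB γ q₀ (v - p.1) p.2 * √(maxwellian p.1)) := by
  have h := abs_mul_sub_mul_le hu.2.1 hu.2.2 hv.1 hv.2.2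
  have hB := hK.nonneg (v - p.1) p.2
  unfold gainIntegrand
  rw [mul_assoc, mul_assoc, ← mul_sub, abs_mul, abs_of_nonneg hB]
  calc _ ≤ kernelB γ q₀ (v - p.1) p.2 * (2 * A * d * (√(maxwellian p.1) * ρ v)) := by
        refine mul_le_mul_of_nonneg_left (h.trans ?_) hB
        exact mul_le_mul_of_nonneg_left (hρ.post_le v p.1 p.2) (by positivity)
    _ = _ := by ring

theorem KernelBound.abs_lossIntegrand_sub_le (hK : KernelBound γ q₀ C) (hρ : CollisionBound ρ)
    (hA : 0 ≤ A) (hd : 0 ≤ d) {p : Vel × Sph} (hu : CloseAt ρ A d G₁ G₂ p.1)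
    (hv : CloseAt ρ A d F₁ F₂ v) :
    |lossIntegrand γ q₀ G₁ F₁ v p - lossIntegrand γ q₀ G₂ F₂ v p| ≤
      2 * A * d * ρ v * (kernelB γ q₀ (v - p.1) p.2 * √(maxwellian p.1)) := by
  have h := abs_mul_sub_mul_le hu.2.1 hu.2.2 hv.1 hv.2.2
  have hB := hK.nonneg (v - p.1) p.2
  unfold lossIntegrand
  rw [mul_assoc, mul_assoc, ← mul_sub, abs_mul, abs_of_nonneg hB]
  calc _ ≤ kernelB γ q₀ (v - p.1) p.2 * (2 * A * d * (√(maxwellian p.1) * ρ v)) := by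
        refine mul_le_mul_of_nonneg_left (h.trans ?_) hB
        exact mul_le_mul_of_nonneg_left
          (mul_le_mul_of_nonneg_right (hρ.le_sqrt _) (hρ.nonneg _)) (by positivity)
    _ = _ := by ring

/-- Comparison with zero turns the difference estimates into size estimates, at the cost of a
harmless factor 2. -/
theorem CloseAt.zero_right {f : Vel → ℝ} (hρ : CollisionBound ρ) (hA : 0 ≤ A)
    (h : |f v| ≤ A * ρ v) : CloseAt ρ A A f (fun _ => 0) v :=
  ⟨h, by simpa using mul_nonneg hA (hρ.nonneg v), by simpa using h⟩

theorem KernelBound.integrable_gainIntegrand (hK : KernelBound γ q₀ C) (hρ : CollisionBound ρ)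
    (hA : 0 ≤ A) (hG : Measurable G₁) (hF : Measurable F₁)
    (hu : ∀ᵐ p ∂((volume : Measure Vel).prod sphMeasure),
      |G₁ (uPost v p.1 p.2)| ≤ A * ρ (uPost v p.1 p.2))
    (hv : ∀ᵐ p ∂((volume : Measure Vel).prod sphMeasure),
      |F₁ (vPost v p.1 p.2)| ≤ A * ρ (vPost v p.1 p.2)) :
    Integrable (gainIntegrand γ q₀ G₁ F₁ v) ((volume : Measure Vel).prod sphMeasure) := by
  refine hK.integrable_of_le (v := v) (M := 2 * A * A * ρ v) (hK.measurable_gainIntegrand hG hF v) ?_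
  filter_upwards [hu, hv] with p h1 h2
  have := hK.abs_gainIntegrand_sub_le hρ hA hA (CloseAt.zero_right hρ hA h1)
    (CloseAt.zero_right hρ hA h2)
  simpa [gainIntegrand] using this

theorem KernelBound.integrable_lossIntegrand (hK : KernelBound γ q₀ C) (hρ : CollisionBound ρ)
    (hA : 0 ≤ A) (hG : Measurable G₁)
    (hu : ∀ᵐ p ∂((volume : Measure Vel).prod sphMeasure), |G₁ p.1| ≤ A * ρ p.1)
    (hv : |F₁ v| ≤ A * ρ v) :
    Integrable (lossIntegrand γ q₀ G₁ F₁ v) ((volume : Measure Vel).prod sphMeasure) := by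
  refine hK.integrable_of_le (v := v) (M := 2 * A * A * ρ v) (hK.measurable_lossIntegrand hG v) ?_
  filter_upwards [hu] with p h1
  have := hK.abs_lossIntegrand_sub_le hρ hA hA (CloseAt.zero_right hρ hA h1)
    (CloseAt.zero_right hρ hA hv)
  simpa [lossIntegrand] using this

/-- The operator `Q₊(G, G) - Q₋(G, F)`. -/
noncomputable def splitCollision (γ : ℝ) (q₀ : ℝ → ℝ) (G F : Vel → ℝ) (v : Vel) : ℝ :=
  gain γ q₀ G G v - loss γ q₀ G F v

/-- Gain and loss each contribute 2 C A d ρ. The assumptions at u', v' and u hold only almost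
everywhere in (u, ω), so that the estimate also serves for uniqueness. -/
theorem KernelBound.abs_splitCollision_sub_le (hK : KernelBound γ q₀ C) (hρ : CollisionBound ρ)
    (hA : 0 ≤ A) (hd : 0 ≤ d) (hG₁ : Measurable G₁) (hG₂ : Measurable G₂)
    (hu : ∀ᵐ p ∂((volume : Measure Vel).prod sphMeasure), CloseAt ρ A d G₁ G₂ (uPost v p.1 p.2))
    (hv : ∀ᵐ p ∂((volume : Measure Vel).prod sphMeasure), CloseAt ρ A d G₁ G₂ (vPost v p.1 p.2))
    (hl : ∀ᵐ p ∂((volume : Measure Vel).prod sphMeasure), CloseAt ρ A d G₁ G₂ p.1)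
    (hF : CloseAt ρ A d F₁ F₂ v) :
    |splitCollision γ q₀ G₁ F₁ v - splitCollision γ q₀ G₂ F₂ v| ≤ 4 * C * A * d * ρ v := by
  have hM : 0 ≤ 2 * A * d * ρ v := mul_nonneg (by positivity) (hρ.nonneg v)
  have h1 : |gain γ q₀ G₁ G₁ v - gain γ q₀ G₂ G₂ v| ≤ 2 * A * d * ρ v * C := by
    unfold gain
    rw [← integral_sub
      (hK.integrable_gainIntegrand hρ hA hG₁ hG₁ (hu.mono fun _ h => h.1) (hv.mono fun _ h => h.1))
      (hK.integrable_gainIntegrand hρ hA hG₂ hG₂ (hu.mono fun _ h => h.2.1)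
        (hv.mono fun _ h => h.2.1))]
    refine hK.abs_integral_le (v := v) hM ?_
    filter_upwards [hu, hv] with p h1 h2 using hK.abs_gainIntegrand_sub_le hρ hA hd h1 h2
  have h2 : |loss γ q₀ G₁ F₁ v - loss γ q₀ G₂ F₂ v| ≤ 2 * A * d * ρ v * C := by
    unfold loss
    rw [← integral_sub
      (hK.integrable_lossIntegrand hρ hA hG₁ (hl.mono fun _ h => h.1) hF.1)
      (hK.integrable_lossIntegrand hρ hA hG₂ (hl.mono fun _ h => h.2.1) hF.2.1)]
    refine hK.abs_integral_le (v := v) hM ?_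
    filter_upwards [hl] with p h1 using hK.abs_lossIntegrand_sub_le hρ hA hd h1 hF
  have h3 : splitCollision γ q₀ G₁ F₁ v - splitCollision γ q₀ G₂ F₂ v =
      (gain γ q₀ G₁ G₁ v - gain γ q₀ G₂ G₂ v) - (loss γ q₀ G₁ F₁ v - loss γ q₀ G₂ F₂ v) := by
    unfold splitCollision; ring
  rw [h3]
  refine (abs_sub _ _).trans ?_
  linarith

/-- The loss term carries the sign of F at v itself, which is why the relaxation leaves that factor
without an absolute value. -/
theorem KernelBound.splitCollision_nonneg (hK : KernelBound γ q₀ C) (hG : ∀ v, 0 ≤ G₁ v)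
    (hF : F₁ v ≤ 0) : 0 ≤ splitCollision γ q₀ G₁ F₁ v := by
  refine sub_nonneg.2 (le_trans (integral_nonpos fun p => ?_) (integral_nonneg fun p => ?_))
  · exact mul_nonpos_of_nonneg_of_nonpos (mul_nonneg (hK.nonneg _ _) (hG _)) hF
  · exact mul_nonneg (mul_nonneg (hK.nonneg _ _) (hG _)) (hG _)

theorem splitCollision_maxwellian (γ : ℝ) (q₀ : ℝ → ℝ) (v : Vel) :
    splitCollision γ q₀ maxwellian maxwellian v = 0 := by
  refine sub_eq_zero.2 (integral_congr_ae (Filter.Eventually.of_forall fun p => ?_))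
  simp only [gainIntegrand, lossIntegrand, mul_assoc, maxwellian_post]

/-! ### Almost everywhere statements and collisions -/

/-- The image of Lebesgue measure is a multiple of Lebesgue measure. The factor may be infinite, but
only null sets matter. -/
theorem quasiMeasurePreserving_of_surjective {L : Vel × Vel →ₗ[ℝ] Vel}
    (hL : Function.Surjective L) :
    Measure.QuasiMeasurePreserving L ((volume : Measure Vel).prod volume) volume := by
  obtain ⟨c, -, hc⟩ := L.exists_map_addHaar_eq_smul_addHaar
    ((volume : Measure Vel).prod volume) volume hL
  refine ⟨L.continuous_of_finiteDimensional.measurable, ?_⟩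
  rw [hc]
  exact Measure.smul_absolutelyContinuous

theorem quasiMeasurePreserving_uPost (ω : Sph) :
    Measure.QuasiMeasurePreserving (fun p : Vel × Vel => uPost p.1 p.2 ω)
      ((volume : Measure Vel).prod volume) volume := by
  let L : Vel × Vel →ₗ[ℝ] Vel := LinearMap.snd ℝ Vel Vel +
    ((innerₛₗ ℝ (ω : Vel)).comp (LinearMap.fst ℝ Vel Vel - LinearMap.snd ℝ Vel Vel)).smulRight
      (ω : Vel)
  have h : (fun p : Vel × Vel => uPost p.1 p.2 ω) = L := by
    ext1 p
    simp [L, uPost, real_inner_comm]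
  rw [h]
  -- Particles of equal velocity are unchanged by a collision.
  refine quasiMeasurePreserving_of_surjective fun x => ⟨(x, x), ?_⟩
  rw [← h]
  simp [uPost]

theorem quasiMeasurePreserving_vPost (ω : Sph) :
    Measure.QuasiMeasurePreserving (fun p : Vel × Vel => vPost p.1 p.2 ω)
      ((volume : Measure Vel).prod volume) volume := by
  let L : Vel × Vel →ₗ[ℝ] Vel := LinearMap.fst ℝ Vel Vel -
    ((innerₛₗ ℝ (ω : Vel)).comp (LinearMap.fst ℝ Vel Vel - LinearMap.snd ℝ Vel Vel)).smulRight
      (ω : Vel)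
  have h : (fun p : Vel × Vel => vPost p.1 p.2 ω) = L := by
    ext1 p
    simp [L, vPost, real_inner_comm]
  rw [h]
  refine quasiMeasurePreserving_of_surjective fun x => ⟨(x, x), ?_⟩
  rw [← h]
  simp [vPost]

/-- For fixed ω the map (v, u) ↦ φ pulls null sets back to null sets. Fubini in ω and the product
with the identity of the torus extend this to (x, v, u, ω), and a last Fubini separates (x, v) from
(u, ω). -/
theorem ae_ae_of_quasiMeasurePreserving {φ : Vel → Vel → Sph → Vel}
    (hφm : Measurable fun p : Vel × (Vel × Sph) => φ p.1 p.2.1 p.2.2)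
    (hφ : ∀ ω, Measure.QuasiMeasurePreserving (fun p : Vel × Vel => φ p.1 p.2 ω)
      ((volume : Measure Vel).prod volume) volume)
    {P : Torus × Vel → Prop} (hP : ∀ᵐ z, P z) :
    ∀ᵐ z : Torus × Vel, ∀ᵐ p ∂((volume : Measure Vel).prod sphMeasure),
      P (z.1, φ z.2 p.1 p.2) := by
  have h1 : Measure.QuasiMeasurePreserving
      (fun p : (Vel × Vel) × Sph => φ p.1.1 p.1.2 p.2)
      (((volume : Measure Vel).prod volume).prod sphMeasure) volume :=
    QuasiMeasurePreserving.prod_of_left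
      (hφm.comp (by fun_prop : Measurable fun p : (Vel × Vel) × Sph => (p.1.1, (p.1.2, p.2))))
      (Filter.Eventually.of_forall hφ)
  have h2 : Measure.QuasiMeasurePreserving
      (fun p : Vel × (Vel × Sph) => φ p.1 p.2.1 p.2.2)
      ((volume : Measure Vel).prod ((volume : Measure Vel).prod sphMeasure)) volume :=
    h1.comp ((measurePreserving_prodAssoc volume volume sphMeasure).symm
      MeasurableEquiv.prodAssoc).quasiMeasurePreserving
  have h3 : Measure.QuasiMeasurePreserving
      (fun p : (Torus × Vel) × (Vel × Sph) => (p.1.1, φ p.1.2 p.2.1 p.2.2))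
      ((volume : Measure (Torus × Vel)).prod ((volume : Measure Vel).prod sphMeasure)) volume :=
    ((QuasiMeasurePreserving.prodMap (Measure.QuasiMeasurePreserving.id (volume : Measure Torus)) h2).comp
      (measurePreserving_prodAssoc (volume : Measure Torus) (volume : Measure Vel)
        ((volume : Measure Vel).prod sphMeasure)).quasiMeasurePreserving :)
  exact Measure.ae_ae_of_ae_prod (ν := (volume : Measure Vel).prod sphMeasure) (h3.ae hP)

theorem ae_ae_uPost {P : Torus × Vel → Prop} (hP : ∀ᵐ z, P z) :
    ∀ᵐ z : Torus × Vel, ∀ᵐ p ∂((volume : Measure Vel).prod sphMeasure),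
      P (z.1, uPost z.2 p.1 p.2) :=
  ae_ae_of_quasiMeasurePreserving continuous_uPost.measurable quasiMeasurePreserving_uPost hP

theorem ae_ae_vPost {P : Torus × Vel → Prop} (hP : ∀ᵐ z, P z) :
    ∀ᵐ z : Torus × Vel, ∀ᵐ p ∂((volume : Measure Vel).prod sphMeasure),
      P (z.1, vPost z.2 p.1 p.2) :=
  ae_ae_of_quasiMeasurePreserving continuous_vPost.measurable quasiMeasurePreserving_vPost hP

theorem ae_ae_fst {P : Torus × Vel → Prop} (hP : ∀ᵐ z, P z) :
    ∀ᵐ z : Torus × Vel, ∀ᵐ p ∂((volume : Measure Vel).prod sphMeasure), P (z.1, p.1) :=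
  ae_ae_of_quasiMeasurePreserving (φ := fun _ u _ => u) (by fun_prop)
    (fun _ => Measure.quasiMeasurePreserving_snd) hP

/-! ### Transport along characteristics -/

/-- Transport is a shear: for each fixed v it translates the torus. The coordinates are swapped to
put it in skew-product form. -/
theorem measurePreserving_backward (r : ℝ) :
    MeasurePreserving (fun z : Torus × Vel => (backward z.1 r z.2, z.2)) := by
  have hm : Measurable fun p : Vel × Torus => backward p.2 r p.1 := by
    unfold backward
    refine measurable_pi_lambda _ fun i => ((measurable_pi_apply i).comp measurable_snd).sub ?_
    exact (AddCircle.measurable_mk').comp (by fun_prop)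
  have h : MeasurePreserving (fun p : Vel × Torus => (p.1, backward p.2 r p.1))
      ((volume : Measure Vel).prod (volume : Measure Torus)) (volume.prod volume) :=
    (MeasurePreserving.id volume).skew_product (g := fun v x => backward x r v) hm
      (Filter.Eventually.of_forall fun v => (measurePreserving_sub_right (volume : Measure Torus)
        (fun i => ((r * v i : ℝ) : UnitAddCircle))).map_eq)
  exact (Measure.measurePreserving_swap.comp h).comp Measure.measurePreserving_swap

theorem continuous_backward :
    Continuous fun p : Torus × ℝ × Vel => backward p.1 p.2.1 p.2.2 := by
  unfold backward
  refine continuous_pi fun i => ((continuous_apply i).comp continuous_fst).sub ?_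
  exact (AddCircle.continuous_mk' 1).comp (by fun_prop)

theorem backward_backward (x : Torus) (r s : ℝ) (v : Vel) :
    backward (backward x r v) s v = backward x (r + s) v := by
  ext1 i
  simp only [backward, add_mul, AddCircle.coe_add]
  abel

theorem backward_zero (x : Torus) (v : Vel) : backward x 0 v = x := by
  ext1 i
  simp [backward]

end

/-! ### The collision operator along characteristics -/

/-- The function `Q₊(G, G) - Q₋(G, F)` of `(t, x, v)`. -/
noncomputable def splitField (γ : ℝ) (q₀ : ℝ → ℝ) (G F : ℝ → Torus × Vel → ℝ) (s : ℝ)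
    (z : Torus × Vel) : ℝ :=
  splitCollision γ q₀ (fun v => G s (z.1, v)) (fun v => F s (z.1, v)) z.2

/-- The right-hand side of the mild equation, with `Q₊(G, G) - Q₋(G, F)` for the collision term. -/
noncomputable def duhamel (γ : ℝ) (q₀ : ℝ → ℝ) (F₀ : Torus × Vel → ℝ)
    (G F : ℝ → Torus × Vel → ℝ) (t : ℝ) (z : Torus × Vel) : ℝ :=
  F₀ (backward z.1 t z.2, z.2) +
    ∫ s in Ioc 0 t, splitField γ q₀ G F s (backward z.1 (t - s) z.2, z.2)

/-- On `[0, T]`, `F₁` and `F₂` are bounded by `A √μ / w` and their difference by `d √μ / w`. -/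
def CloseOn (q ϑ β T A d : ℝ) (F₁ F₂ : ℝ → Torus × Vel → ℝ) : Prop :=
  ∀ t ∈ Icc (0 : ℝ) T, ∀ x : Torus, ∀ v : Vel,
    CloseAt (envelope q ϑ β t) A d (fun u => F₁ t (x, u)) (fun u => F₂ t (x, u)) v

theorem collisionBound_envelope {q ϑ β : ℝ} (hq : 0 < q) (hβ : 0 ≤ β) {t : ℝ} (ht : 0 ≤ t) :
    CollisionBound (envelope q ϑ β t) :=
  ⟨fun _ => (envelope_pos ..).le, envelope_le hq hβ ht, envelope_mul_post_le hq hβ ht⟩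

section

variable {γ : ℝ} {q₀ : ℝ → ℝ} {C : ℝ}

theorem measurable_slice {F : ℝ → Torus × Vel → ℝ}
    (hF : Measurable fun p : ℝ × (Torus × Vel) => F p.1 p.2) (s : ℝ) (x : Torus) :
    Measurable fun v => F s (x, v) :=
  hF.comp (measurable_prodMk_left.comp measurable_prodMk_left)

theorem KernelBound.measurable_splitField (hK : KernelBound γ q₀ C) {G F : ℝ → Torus × Vel → ℝ}
    (hG : Measurable fun p : ℝ × (Torus × Vel) => G p.1 p.2)
    (hF : Measurable fun p : ℝ × (Torus × Vel) => F p.1 p.2) :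
    Measurable fun p : ℝ × (Torus × Vel) => splitField γ q₀ G F p.1 p.2 := by
  have e : Measurable fun a : (ℝ × (Torus × Vel)) × (Vel × Sph) => (a.1.2.2, a.2) := by fun_prop
  have hB := hK.measurable_kernel.comp e
  have eG : ∀ φ : (Vel × (Vel × Sph)) → Vel, Measurable φ →
      Measurable fun a : (ℝ × (Torus × Vel)) × (Vel × Sph) =>
        (a.1.1, (a.1.2.1, φ (a.1.2.2, a.2))) := fun φ hφ =>
    measurable_fst.fst.prodMk (measurable_fst.snd.fst.prodMk (hφ.comp e))
  have hu := eG _ continuous_uPost.measurable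
  have hv := eG _ continuous_vPost.measurable
  have hl := eG (fun p => p.2.1) measurable_snd.fst
  have h1 : Measurable fun a : (ℝ × (Torus × Vel)) × (Vel × Sph) =>
      gainIntegrand γ q₀ (fun v => G a.1.1 (a.1.2.1, v)) (fun v => G a.1.1 (a.1.2.1, v))
        a.1.2.2 a.2 :=
    (hB.mul (hG.comp hu)).mul (hG.comp hv)
  have h2 : Measurable fun a : (ℝ × (Torus × Vel)) × (Vel × Sph) =>
      lossIntegrand γ q₀ (fun v => G a.1.1 (a.1.2.1, v)) (fun v => F a.1.1 (a.1.2.1, v))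
        a.1.2.2 a.2 :=
    (hB.mul (hG.comp hl)).mul (hF.comp measurable_fst)
  have h3 := StronglyMeasurable.integral_prod_right (ν := (volume : Measure Vel).prod sphMeasure)
    (f := fun (p : ℝ × (Torus × Vel)) (a : Vel × Sph) =>
      gainIntegrand γ q₀ (fun v => G p.1 (p.2.1, v)) (fun v => G p.1 (p.2.1, v)) p.2.2 a)
    h1.stronglyMeasurable
  have h4 := StronglyMeasurable.integral_prod_right (ν := (volume : Measure Vel).prod sphMeasure)
    (f := fun (p : ℝ × (Torus × Vel)) (a : Vel × Sph) =>
      lossIntegrand γ q₀ (fun v => G p.1 (p.2.1, v)) (fun v => F p.1 (p.2.1, v)) p.2.2 a)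
    h2.stronglyMeasurable
  exact h3.measurable.sub h4.measurable

theorem measurable_characteristic :
    Measurable fun a : (ℝ × (Torus × Vel)) × ℝ =>
      (a.2, (backward a.1.2.1 (a.1.1 - a.2) a.1.2.2, a.1.2.2)) := by
  have h : Measurable fun a : (ℝ × (Torus × Vel)) × ℝ => (a.1.2.1, a.1.1 - a.2, a.1.2.2) := by
    fun_prop
  exact measurable_snd.prodMk ((continuous_backward.measurable.comp h).prodMk measurable_fst.snd.snd)

theorem KernelBound.measurable_characteristic_splitField (hK : KernelBound γ q₀ C)
    {G F : ℝ → Torus × Vel → ℝ}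
    (hG : Measurable fun p : ℝ × (Torus × Vel) => G p.1 p.2)
    (hF : Measurable fun p : ℝ × (Torus × Vel) => F p.1 p.2) :
    Measurable fun a : (ℝ × (Torus × Vel)) × ℝ =>
      splitField γ q₀ G F a.2 (backward a.1.2.1 (a.1.1 - a.2) a.1.2.2, a.1.2.2) :=
  (hK.measurable_splitField hG hF).comp measurable_characteristic

theorem KernelBound.measurable_duhamel (hK : KernelBound γ q₀ C) {F₀ : Torus × Vel → ℝ}
    (hF₀ : Measurable F₀) {G F : ℝ → Torus × Vel → ℝ}
    (hG : Measurable fun p : ℝ × (Torus × Vel) => G p.1 p.2)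
    (hF : Measurable fun p : ℝ × (Torus × Vel) => F p.1 p.2) :
    Measurable fun p : ℝ × (Torus × Vel) => duhamel γ q₀ F₀ G F p.1 p.2 := by
  have h0 : Measurable fun p : ℝ × (Torus × Vel) => (p.2.1, p.1, p.2.2) := by fun_prop
  have h1 : Measurable fun p : ℝ × (Torus × Vel) => F₀ (backward p.2.1 p.1 p.2.2, p.2.2) :=
    hF₀.comp ((continuous_backward.measurable.comp h0).prodMk measurable_snd.snd)
  have hS : MeasurableSet {a : (ℝ × (Torus × Vel)) × ℝ | a.2 ∈ Ioc 0 a.1.1} :=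
    (measurableSet_lt measurable_const measurable_snd).inter
      (measurableSet_le measurable_snd measurable_fst.fst)
  have h2 := (hK.measurable_characteristic_splitField hG hF).indicator hS
  -- An indicator replaces the interval depending on t, so that the integral is over a fixed space.
  have h3 := StronglyMeasurable.integral_prod_right (ν := (volume : Measure ℝ))
    (f := fun (p : ℝ × (Torus × Vel)) (s : ℝ) => (Ioc 0 p.1).indicator
      (fun s => splitField γ q₀ G F s (backward p.2.1 (p.1 - s) p.2.2, p.2.2)) s)
    h2.stronglyMeasurable
  simp only [integral_indicator measurableSet_Ioc] at h3
  exact h1.add h3.measurable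

variable {q ϑ β T A d : ℝ} {G₁ G₂ F₁ F₂ : ℝ → Torus × Vel → ℝ}

theorem CloseOn.abs (h : CloseOn q ϑ β T A d F₁ F₂) :
    CloseOn q ϑ β T A d (fun t z => |F₁ t z|) (fun t z => |F₂ t z|) :=
  fun t ht x v => (h t ht x v).abs

theorem CloseOn.zero_right (hA : 0 ≤ A) (h : CloseOn q ϑ β T A d F₁ F₂) :
    CloseOn q ϑ β T A A F₁ (fun _ _ => 0) := fun t ht x v =>
  ⟨(h t ht x v).1, by simpa using mul_nonneg hA (envelope_pos ..).le,
    by simpa using (h t ht x v).1⟩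

theorem CloseOn.symm (h : CloseOn q ϑ β T A d F₁ F₂) : CloseOn q ϑ β T A d F₂ F₁ :=
  fun t ht x v => ⟨(h t ht x v).2.1, (h t ht x v).1, by
    have := (h t ht x v).2.2
    rwa [abs_sub_comm] at this⟩

theorem KernelBound.abs_splitField_sub_le (hK : KernelBound γ q₀ C) (hq : 0 < q) (hβ : 0 ≤ β)
    (hA : 0 ≤ A) (hd : 0 ≤ d)
    (hG₁ : Measurable fun p : ℝ × (Torus × Vel) => G₁ p.1 p.2)
    (hG₂ : Measurable fun p : ℝ × (Torus × Vel) => G₂ p.1 p.2)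
    (hG : CloseOn q ϑ β T A d G₁ G₂) (hF : CloseOn q ϑ β T A d F₁ F₂) {s : ℝ}
    (hs : s ∈ Icc 0 T) (z : Torus × Vel) :
    |splitField γ q₀ G₁ F₁ s z - splitField γ q₀ G₂ F₂ s z| ≤
      4 * C * A * d * envelope q ϑ β s z.2 :=
  hK.abs_splitCollision_sub_le (collisionBound_envelope hq hβ hs.1) hA hd
    (measurable_slice hG₁ s z.1) (measurable_slice hG₂ s z.1)
    (Eventually.of_forall fun _ => hG s hs z.1 _) (Eventually.of_forall fun _ => hG s hs z.1 _)
    (Eventually.of_forall fun _ => hG s hs z.1 _) (hF s hs z.1 z.2)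

theorem splitField_zero (γ : ℝ) (q₀ : ℝ → ℝ) (s : ℝ) (z : Torus × Vel) :
    splitField γ q₀ (fun _ _ => 0) (fun _ _ => 0) s z = 0 := by
  simp [splitField, splitCollision, gain, loss, gainIntegrand, lossIntegrand]

theorem KernelBound.integrableOn_splitField (hK : KernelBound γ q₀ C) (hq : 0 < q) (hϑ : 0 ≤ ϑ)
    (hβ : 0 ≤ β) (hA : 0 ≤ A)
    (hG₁ : Measurable fun p : ℝ × (Torus × Vel) => G₁ p.1 p.2)
    (hF₁ : Measurable fun p : ℝ × (Torus × Vel) => F₁ p.1 p.2)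
    (hG : CloseOn q ϑ β T A A G₁ (fun _ _ => 0)) (hF : CloseOn q ϑ β T A A F₁ (fun _ _ => 0))
    {t : ℝ} (ht : t ∈ Icc 0 T) (z : Torus × Vel) :
    IntegrableOn (fun s => splitField γ q₀ G₁ F₁ s (backward z.1 (t - s) z.2, z.2)) (Ioc 0 t) := by
  have hm := (hK.measurable_characteristic_splitField hG₁ hF₁).comp
    (measurable_prodMk_left (x := (t, z)))
  refine Measure.integrableOn_of_bounded (M := 4 * C * A * A * envelope q ϑ β t z.2)
    measure_Ioc_lt_top.ne hm.aestronglyMeasurable ?_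
  refine (ae_restrict_iff' measurableSet_Ioc).2 (Eventually.of_forall fun s hs => ?_)
  have h := hK.abs_splitField_sub_le hq hβ hA hA hG₁ measurable_const hG hF
    (⟨hs.1.le, hs.2.trans ht.2⟩ : s ∈ Icc 0 T) (backward z.1 (t - s) z.2, z.2)
  rw [splitField_zero, sub_zero] at h
  have hC := hK.constant_nonneg
  exact h.trans (mul_le_mul_of_nonneg_left (envelope_mono hq hϑ hs.1.le hs.2 _) (by positivity))

theorem KernelBound.abs_duhamel_sub_le (hK : KernelBound γ q₀ C) (hq : 0 < q) (hϑ : 0 ≤ ϑ)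
    (hβ : 0 ≤ β) (hA : 0 ≤ A) (hd : 0 ≤ d) (F₀ : Torus × Vel → ℝ)
    (hG₁ : Measurable fun p : ℝ × (Torus × Vel) => G₁ p.1 p.2)
    (hG₂ : Measurable fun p : ℝ × (Torus × Vel) => G₂ p.1 p.2)
    (hF₁ : Measurable fun p : ℝ × (Torus × Vel) => F₁ p.1 p.2)
    (hF₂ : Measurable fun p : ℝ × (Torus × Vel) => F₂ p.1 p.2)
    (hG : CloseOn q ϑ β T A d G₁ G₂) (hF : CloseOn q ϑ β T A d F₁ F₂)
    {t : ℝ} (ht : t ∈ Icc 0 T) (z : Torus × Vel) :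
    |duhamel γ q₀ F₀ G₁ F₁ t z - duhamel γ q₀ F₀ G₂ F₂ t z| ≤
      4 * C * A * T * d * envelope q ϑ β t z.2 := by
  have hC := hK.constant_nonneg
  have hρ := (envelope_pos q ϑ β t z.2).le
  unfold duhamel
  rw [add_sub_add_left_eq_sub, ← integral_sub
    (hK.integrableOn_splitField hq hϑ hβ hA hG₁ hF₁ (hG.zero_right hA) (hF.zero_right hA) ht z)
    (hK.integrableOn_splitField hq hϑ hβ hA hG₂ hF₂ (hG.symm.zero_right hA)
      (hF.symm.zero_right hA) ht z)]
  have h := norm_setIntegral_le_of_norm_le_const (μ := (volume : Measure ℝ)) (s := Ioc 0 t)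
    (f := fun s => splitField γ q₀ G₁ F₁ s (backward z.1 (t - s) z.2, z.2) -
      splitField γ q₀ G₂ F₂ s (backward z.1 (t - s) z.2, z.2))
    (C := 4 * C * A * d * envelope q ϑ β t z.2) measure_Ioc_lt_top fun s hs =>
      (hK.abs_splitField_sub_le hq hβ hA hd hG₁ hG₂ hG hF
        (⟨hs.1.le, hs.2.trans ht.2⟩ : s ∈ Icc 0 T) (backward z.1 (t - s) z.2, z.2)).trans
        (mul_le_mul_of_nonneg_left (envelope_mono hq hϑ hs.1.le hs.2 _) (by positivity))
  refine h.trans ?_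
  rw [Real.volume_real_Ioc_of_le ht.1, sub_zero]
  calc _ ≤ 4 * C * A * d * envelope q ϑ β t z.2 * T :=
        mul_le_mul_of_nonneg_left ht.2 (by positivity)
    _ = _ := by ring

/-! ### Existence -/

/-- A function with nonnegative initial value that increases wherever it is not positive is
nonnegative. -/
theorem nonneg_of_integral_eq {y ψ : ℝ → ℝ} {y₀ t : ℝ} (ht : 0 ≤ t) (hy₀ : 0 ≤ y₀)
    (hψ : IntegrableOn ψ (Ioc 0 t)) (hy : ∀ s ∈ Icc 0 t, y s = y₀ + ∫ r in Ioc 0 s, ψ r)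
    (hpos : ∀ s ∈ Ioc 0 t, y s ≤ 0 → 0 ≤ ψ s) : 0 ≤ y t := by
  have hψ' : IntervalIntegrable ψ volume 0 t :=
    (intervalIntegrable_iff_integrableOn_Ioc_of_le ht).2 hψ
  have hy' : ∀ s ∈ Icc 0 t, y s = y₀ + ∫ r in (0 : ℝ)..s, ψ r := fun s hs => by
    rw [intervalIntegral.integral_of_le hs.1, hy s hs]
  have hc : ContinuousOn y (Icc 0 t) := by
    have h := intervalIntegral.continuousOn_primitive_interval' hψ' left_mem_uIcc
    rw [uIcc_of_le ht] at h
    exact (continuousOn_const.add h).congr hy'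
  have hK : IsCompact (Icc 0 t ∩ y ⁻¹' Ici 0) :=
    isCompact_Icc.of_isClosed_subset (hc.preimage_isClosed_of_isClosed isClosed_Icc isClosed_Ici)
      inter_subset_left
  have h0 : (0 : ℝ) ∈ Icc 0 t ∩ y ⁻¹' Ici 0 := by
    refine ⟨⟨le_rfl, ht⟩, ?_⟩
    have := hy 0 ⟨le_rfl, ht⟩
    simp only [Ioc_self, Measure.restrict_empty, integral_zero_measure, add_zero] at this
    simpa [this] using hy₀
  -- Let s₀ be the last time at which y ≥ 0. Afterwards y < 0, hence ψ ≥ 0, and so y t ≥ y s₀.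
  obtain ⟨s₀, ⟨hs₀, hys₀⟩, hmax⟩ := hK.exists_isGreatest ⟨0, h0⟩
  have hys₀' : 0 ≤ y s₀ := hys₀
  have hi : ∀ a ∈ Icc 0 t, ∀ b ∈ Icc 0 t, IntervalIntegrable ψ volume a b := fun a ha b hb =>
    hψ'.mono_set (by rw [uIcc_of_le ht]; exact uIcc_subset_Icc ha hb)
  have hsplit : y t = y s₀ + ∫ r in s₀..t, ψ r := by
    rw [hy' t ⟨ht, le_rfl⟩, hy' s₀ hs₀, add_assoc,
      intervalIntegral.integral_add_adjacent_intervals (hi 0 ⟨le_rfl, ht⟩ s₀ hs₀)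
        (hi s₀ hs₀ t ⟨ht, le_rfl⟩)]
  have hint : 0 ≤ ∫ r in s₀..t, ψ r := by
    rw [intervalIntegral.integral_of_le hs₀.2]
    refine setIntegral_nonneg measurableSet_Ioc fun r hr => ?_
    have hr' : r ∈ Ioc 0 t := ⟨hs₀.1.trans_lt hr.1, hr.2⟩
    refine hpos r hr' (le_of_not_gt fun hyr => ?_)
    exact absurd (hmax ⟨⟨hr'.1.le, hr'.2⟩, hyr.le⟩) (not_le.2 hr.1)
  linarith

/-- The Picard iterates of the equation with collision term `Q₊(|F|, |F|) - Q₋(|F|, F)`. -/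
noncomputable def picard (γ : ℝ) (q₀ : ℝ → ℝ) (F₀ : Torus × Vel → ℝ) :
    ℕ → ℝ → Torus × Vel → ℝ
  | 0 => fun _ z => maxwellian z.2
  | n + 1 => duhamel γ q₀ F₀ (fun t z => |picard γ q₀ F₀ n t z|) (picard γ q₀ F₀ n)

theorem measurable_abs_uncurry {F : ℝ → Torus × Vel → ℝ}
    (hF : Measurable fun p : ℝ × (Torus × Vel) => F p.1 p.2) :
    Measurable fun p : ℝ × (Torus × Vel) => |F p.1 p.2| :=
  continuous_abs.measurable.comp hF

theorem KernelBound.measurable_picard (hK : KernelBound γ q₀ C) {F₀ : Torus × Vel → ℝ}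
    (hF₀ : Measurable F₀) (n : ℕ) :
    Measurable fun p : ℝ × (Torus × Vel) => picard γ q₀ F₀ n p.1 p.2 := by
  induction n with
  | zero => exact measurable_maxwellian.comp measurable_snd.snd
  | succ n ih => exact hK.measurable_duhamel hF₀ (measurable_abs_uncurry ih) ih

theorem duhamel_maxwellian (γ : ℝ) (q₀ : ℝ → ℝ) (F₀ : Torus × Vel → ℝ) (t : ℝ)
    (z : Torus × Vel) :
    duhamel γ q₀ F₀ (fun _ z => |maxwellian z.2|) (fun _ z => maxwellian z.2) t z =
      F₀ (backward z.1 t z.2, z.2) := by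
  have h : ∀ s w, splitField γ q₀ (fun _ z => |maxwellian z.2|) (fun _ z => maxwellian z.2) s w
      = 0 := fun s w => by
    simp only [abs_of_pos (maxwellian_pos _)]
    exact splitCollision_maxwellian γ q₀ w.2
  simp [duhamel, h]

variable {F₀ : Torus × Vel → ℝ} {M D : ℝ}

/-- Two functions whose distances to `μ` are at most `M √μ / w`, close to one another. -/
theorem closeOn_of_abs_sub_maxwellian_le
    (hD : ∀ t, 0 ≤ t → ∀ v : Vel, maxwellian v ≤ D * envelope q ϑ β t v)
    (h₁ : ∀ t ∈ Icc 0 T, ∀ z, |F₁ t z - maxwellian z.2| ≤ M * envelope q ϑ β t z.2)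
    (h₂ : ∀ t ∈ Icc 0 T, ∀ z, |F₂ t z - maxwellian z.2| ≤ M * envelope q ϑ β t z.2)
    (h : ∀ t ∈ Icc 0 T, ∀ z, |F₁ t z - F₂ t z| ≤ d * envelope q ϑ β t z.2) :
    CloseOn q ϑ β T (D + M) d F₁ F₂ := by
  have aux : ∀ F : ℝ → Torus × Vel → ℝ,
      (∀ t ∈ Icc 0 T, ∀ z, |F t z - maxwellian z.2| ≤ M * envelope q ϑ β t z.2) →
      ∀ t ∈ Icc 0 T, ∀ z, |F t z| ≤ (D + M) * envelope q ϑ β t z.2 := fun F hF t ht z => by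
    have h1 := abs_le.1 (hF t ht z)
    have h2 := hD t ht.1 z.2
    have h3 := maxwellian_pos z.2
    rw [add_mul, abs_le]
    constructor <;> linarith [h1.1, h1.2]
  exact fun t ht x v => ⟨aux F₁ h₁ t ht (x, v), aux F₂ h₂ t ht (x, v), h t ht (x, v)⟩

/-- Absolute values do not increase distances, so the relaxed map has Lipschitz constant 4CAT, which
the smallness of T makes at most 1/2. -/
theorem KernelBound.abs_relaxed_duhamel_sub_le (hK : KernelBound γ q₀ C) (hq : 0 < q)
    (hϑ : 0 ≤ ϑ) (hβ : 0 ≤ β) (hA : 0 ≤ A) (hd : 0 ≤ d) (hT : 4 * C * A * T ≤ 1 / 2)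
    (F₀ : Torus × Vel → ℝ)
    (hF₁ : Measurable fun p : ℝ × (Torus × Vel) => F₁ p.1 p.2)
    (hF₂ : Measurable fun p : ℝ × (Torus × Vel) => F₂ p.1 p.2)
    (hF : CloseOn q ϑ β T A d F₁ F₂) {t : ℝ} (ht : t ∈ Icc 0 T) (z : Torus × Vel) :
    |duhamel γ q₀ F₀ (fun t z => |F₁ t z|) F₁ t z -
      duhamel γ q₀ F₀ (fun t z => |F₂ t z|) F₂ t z| ≤ d / 2 * envelope q ϑ β t z.2 := by
  refine (hK.abs_duhamel_sub_le hq hϑ hβ hA hd F₀ (measurable_abs_uncurry hF₁)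
    (measurable_abs_uncurry hF₂) hF₁ hF₂ hF.abs hF ht z).trans ?_
  refine mul_le_mul_of_nonneg_right ?_ (envelope_pos ..).le
  nlinarith

/-- Applied to μ, the Duhamel map merely transports the data, since Q(μ, μ) = 0. An iterate within
2M of μ is thus sent within M of the transported data, which are within M of μ. -/
theorem KernelBound.abs_picard_sub_maxwellian_le (hK : KernelBound γ q₀ C) (hq : 0 < q)
    (hϑ : 0 ≤ ϑ) (hβ : 0 ≤ β) (hD0 : 0 ≤ D)
    (hD : ∀ t, 0 ≤ t → ∀ v : Vel, maxwellian v ≤ D * envelope q ϑ β t v)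
    (hF₀ : Measurable F₀) (hM : 0 ≤ M)
    (hF₀M : ∀ z, |F₀ z - maxwellian z.2| ≤ M * envelope q ϑ β 0 z.2)
    (hT : 4 * C * (D + 2 * M) * T ≤ 1 / 2) (n : ℕ) :
    ∀ t ∈ Icc 0 T, ∀ z,
      |picard γ q₀ F₀ n t z - maxwellian z.2| ≤ 2 * M * envelope q ϑ β t z.2 := by
  have h0 : ∀ t ∈ Icc 0 T, ∀ z : Torus × Vel,
      |maxwellian z.2 - maxwellian z.2| ≤ 2 * M * envelope q ϑ β t z.2 := fun t ht z => by
    have := (envelope_pos q ϑ β t z.2).le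
    simp only [sub_self, abs_zero]
    positivity
  induction n with
  | zero => exact h0
  | succ n ih =>
    intro t ht z
    have h := hK.abs_relaxed_duhamel_sub_le hq hϑ hβ (by positivity) (by positivity) hT F₀
      (hK.measurable_picard hF₀ n) (measurable_maxwellian.comp measurable_snd.snd)
      (closeOn_of_abs_sub_maxwellian_le (F₂ := fun _ z => maxwellian z.2) hD ih h0 ih) ht z
    rw [duhamel_maxwellian] at h
    have h' := (hF₀M (backward z.1 t z.2, z.2)).trans
      (mul_le_mul_of_nonneg_left (envelope_mono hq hϑ le_rfl ht.1 z.2) hM)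
    have h3 := abs_sub_le (picard γ q₀ F₀ (n + 1) t z) (F₀ (backward z.1 t z.2, z.2))
      (maxwellian z.2)
    have h4 : |picard γ q₀ F₀ (n + 1) t z - F₀ (backward z.1 t z.2, z.2)| ≤
      2 * M / 2 * envelope q ϑ β t z.2 := h
    dsimp only at h'
    linarith

theorem KernelBound.abs_picard_succ_sub_le (hK : KernelBound γ q₀ C) (hq : 0 < q)
    (hϑ : 0 ≤ ϑ) (hβ : 0 ≤ β) (hD0 : 0 ≤ D)
    (hD : ∀ t, 0 ≤ t → ∀ v : Vel, maxwellian v ≤ D * envelope q ϑ β t v)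
    (hF₀ : Measurable F₀) (hM : 0 ≤ M)
    (hF₀M : ∀ z, |F₀ z - maxwellian z.2| ≤ M * envelope q ϑ β 0 z.2)
    (hT : 4 * C * (D + 2 * M) * T ≤ 1 / 2) (n : ℕ) :
    ∀ t ∈ Icc 0 T, ∀ z, |picard γ q₀ F₀ (n + 1) t z - picard γ q₀ F₀ n t z| ≤
      2 * M * (1 / 2) ^ n * envelope q ϑ β t z.2 := by
  have hb := hK.abs_picard_sub_maxwellian_le hq hϑ hβ hD0 hD hF₀ hM hF₀M hT
  induction n with
  -- The zeroth iterate is μ, so this is the preceding bound for the first iterate.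
  | zero => simpa [picard] using hb 1
  | succ n ih =>
    intro t ht z
    have h := hK.abs_relaxed_duhamel_sub_le hq hϑ hβ (by positivity) (by positivity) hT F₀
      (hK.measurable_picard hF₀ (n + 1)) (hK.measurable_picard hF₀ n)
      (closeOn_of_abs_sub_maxwellian_le hD (hb (n + 1)) (hb n) ih) ht z
    refine h.trans_eq ?_
    ring

theorem KernelBound.exists_fixedPoint (hK : KernelBound γ q₀ C) (hq : 0 < q)
    (hϑ : 0 ≤ ϑ) (hβ : 0 ≤ β) (hD0 : 0 ≤ D)
    (hD : ∀ t, 0 ≤ t → ∀ v : Vel, maxwellian v ≤ D * envelope q ϑ β t v)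
    (hF₀ : Measurable F₀) (hM : 0 ≤ M)
    (hF₀M : ∀ z, |F₀ z - maxwellian z.2| ≤ M * envelope q ϑ β 0 z.2)
    (hT : 4 * C * (D + 2 * M) * T ≤ 1 / 2) :
    ∃ F : ℝ → Torus × Vel → ℝ, (Measurable fun p : ℝ × (Torus × Vel) => F p.1 p.2) ∧
      (∀ t ∈ Icc 0 T, ∀ z, |F t z - maxwellian z.2| ≤ 2 * M * envelope q ϑ β t z.2) ∧
      ∀ t ∈ Icc 0 T, ∀ z, F t z = duhamel γ q₀ F₀ (fun t z => |F t z|) F t z := by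
  have hb := hK.abs_picard_sub_maxwellian_le hq hϑ hβ hD0 hD hF₀ hM hF₀M hT
  have hs := hK.abs_picard_succ_sub_le hq hϑ hβ hD0 hD hF₀ hM hF₀M hT
  have hdist : ∀ t ∈ Icc 0 T, ∀ z n, dist (picard γ q₀ F₀ n t z) (picard γ q₀ F₀ (n + 1) t z) ≤
      2 * M * envelope q ϑ β t z.2 * (1 / 2) ^ n := fun t ht z n => by
    rw [dist_comm, Real.dist_eq]
    exact (hs n t ht z).trans_eq (by ring)
  -- `limUnder` gives a function measurable for all times; convergence is claimed only on [0, T].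
  let F : ℝ → Torus × Vel → ℝ := fun t z => limUnder atTop fun n => picard γ q₀ F₀ n t z
  have hFm : Measurable fun p : ℝ × (Torus × Vel) => F p.1 p.2 :=
    (StronglyMeasurable.limUnder (l := atTop) fun n =>
      (hK.measurable_picard hF₀ n).stronglyMeasurable).measurable
  have hlim : ∀ t ∈ Icc 0 T, ∀ z, Tendsto (fun n => picard γ q₀ F₀ n t z) atTop (𝓝 (F t z)) :=
    fun t ht z => CauchySeq.tendsto_limUnder (cauchySeq_of_le_geometric _ _ (by norm_num) (hdist t ht z))
  have hFM : ∀ t ∈ Icc 0 T, ∀ z, |F t z - maxwellian z.2| ≤ 2 * M * envelope q ϑ β t z.2 :=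
    fun t ht z => le_of_tendsto ((hlim t ht z).sub_const _).abs
      (Eventually.of_forall fun n => hb n t ht z)
  have hclose : ∀ n, ∀ t ∈ Icc 0 T, ∀ z,
      |picard γ q₀ F₀ n t z - F t z| ≤ 4 * M * (1 / 2) ^ n * envelope q ϑ β t z.2 :=
    fun n t ht z => by
      have h := dist_le_of_le_geometric_of_tendsto (1 / 2) _ (by norm_num) (hdist t ht z)
        (hlim t ht z) n
      rw [Real.dist_eq] at h
      exact h.trans_eq (by ring)
  refine ⟨F, hFm, hFM, fun t ht z => ?_⟩
  -- The shifted iterates tend to F, and by the contraction also to the Duhamel map of F.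
  refine tendsto_nhds_unique ((hlim t ht z).comp (tendsto_add_atTop_nat 1)) ?_
  refine tendsto_iff_dist_tendsto_zero.2 (squeeze_zero (fun _ => dist_nonneg) (fun n => ?_)
    (g := fun n : ℕ => 2 * M * envelope q ϑ β t z.2 * (1 / 2) ^ n) ?_)
  · have h := hK.abs_relaxed_duhamel_sub_le hq hϑ hβ (by positivity) (by positivity) hT F₀
      (hK.measurable_picard hF₀ n) hFm
      (closeOn_of_abs_sub_maxwellian_le hD (hb n) hFM (hclose n)) ht z
    rw [Real.dist_eq]
    exact h.trans_eq (by ring)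
  · simpa using (tendsto_pow_atTop_nhds_zero_of_lt_one (r := (1 / 2 : ℝ)) (by norm_num)
      (by norm_num)).const_mul (2 * M * envelope q ϑ β t z.2)

/-- A fixed point of the relaxed equation with nonnegative data is nonnegative. -/
theorem KernelBound.nonneg_of_eq_duhamel (hK : KernelBound γ q₀ C) (hq : 0 < q)
    (hϑ : 0 ≤ ϑ) (hβ : 0 ≤ β) (hA : 0 ≤ A) (hF₀ : ∀ z, 0 ≤ F₀ z)
    (hF₁ : Measurable fun p : ℝ × (Torus × Vel) => F₁ p.1 p.2)
    (hF : CloseOn q ϑ β T A A F₁ (fun _ _ => 0))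
    (heq : ∀ t ∈ Icc 0 T, ∀ z, F₁ t z = duhamel γ q₀ F₀ (fun t z => |F₁ t z|) F₁ t z)
    {t : ℝ} (ht : t ∈ Icc 0 T) (z : Torus × Vel) : 0 ≤ F₁ t z := by
  have h0 : CloseOn q ϑ β T A A (fun t z => |F₁ t z|) (fun _ _ => 0) := by simpa using hF.abs
  -- The solution is followed along the characteristic that ends at z at time t.
  have h := nonneg_of_integral_eq (y := fun s => F₁ s (backward z.1 (t - s) z.2, z.2)) ht.1
    (hF₀ (backward z.1 t z.2, z.2))
    (hK.integrableOn_splitField hq hϑ hβ hA (measurable_abs_uncurry hF₁) hF₁ h0 hF ht z)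
    (fun s hs => ?_) (fun s hs hle => ?_)
  · simpa [backward_zero] using h
  · rw [heq s ⟨hs.1, hs.2.trans ht.2⟩]
    simp only [duhamel, backward_backward, sub_add_cancel, sub_add_sub_cancel]
  · exact hK.splitCollision_nonneg (fun v => abs_nonneg _) hle

theorem KernelBound.exists_solution (hK : KernelBound γ q₀ C) (hq : 0 < q)
    (hϑ : 0 ≤ ϑ) (hβ : 0 ≤ β) (hD0 : 0 ≤ D)
    (hD : ∀ t, 0 ≤ t → ∀ v : Vel, maxwellian v ≤ D * envelope q ϑ β t v)
    (hF₀ : Measurable F₀) (hF₀nn : ∀ z, 0 ≤ F₀ z) (hM : 0 ≤ M)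
    (hF₀M : ∀ z, |F₀ z - maxwellian z.2| ≤ M * envelope q ϑ β 0 z.2) :
    ∃ T > 0, ∃ F : ℝ → Torus × Vel → ℝ,
      (Measurable fun p : ℝ × (Torus × Vel) => F p.1 p.2) ∧
      (∀ t ∈ Icc 0 T, ∀ z, |F t z - maxwellian z.2| ≤ 2 * M * envelope q ϑ β t z.2) ∧
      (∀ t ∈ Icc 0 T, ∀ z, 0 ≤ F t z) ∧
      ∀ t ∈ Icc 0 T, ∀ z, F t z = duhamel γ q₀ F₀ F F t z := by
  have hC := hK.constant_nonneg
  have hA : 0 ≤ D + 2 * M := by positivity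
  -- The existence time is the inverse of this number; the 1 covers the case where the product
  -- vanishes.
  have hpos : 0 < 8 * C * (D + 2 * M) + 1 := by positivity
  have hT : 4 * C * (D + 2 * M) * (1 / (8 * C * (D + 2 * M) + 1)) ≤ 1 / 2 := by
    rw [mul_one_div, div_le_iff₀ hpos]
    linarith
  obtain ⟨F, hFm, hFM, heq⟩ := hK.exists_fixedPoint hq hϑ hβ hD0 hD hF₀ hM hF₀M hT
  have hF : CloseOn q ϑ β _ (D + 2 * M) _ F (fun _ _ => 0) :=
    (closeOn_of_abs_sub_maxwellian_le hD hFM hFM (d := 0) (by simp)).zero_right hA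
  have hnn := fun t ht z => hK.nonneg_of_eq_duhamel hq hϑ hβ hA hF₀nn hFm hF heq (t := t) ht z
  refine ⟨_, by positivity, F, hFm, hFM, hnn, fun t ht z => ?_⟩
  rw [heq t ht z]
  refine congrArg _ (setIntegral_congr_fun measurableSet_Ioc fun s hs => ?_)
  have hs' := fun v => hnn s ⟨hs.1.le, hs.2.trans ht.2⟩ (backward z.1 (t - s) z.2, v)
  simp only [splitField, abs_of_nonneg (hs' _)]

end

section

variable {γ : ℝ} {q₀ : ℝ → ℝ} {C q ϑ β T A d : ℝ} {F G : ℝ → Torus × Vel → ℝ}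
  {F₀ : Torus × Vel → ℝ}

/-! ### Uniqueness -/

theorem KernelBound.ae_abs_splitField_sub_le (hK : KernelBound γ q₀ C) (hq : 0 < q) (hβ : 0 ≤ β)
    (hA : 0 ≤ A) (hd : 0 ≤ d)
    (hFm : Measurable fun p : ℝ × (Torus × Vel) => F p.1 p.2)
    (hGm : Measurable fun p : ℝ × (Torus × Vel) => G p.1 p.2) {s : ℝ} (hs : 0 ≤ s)
    (h : ∀ᵐ z : Torus × Vel, CloseAt (envelope q ϑ β s) A d (fun v => F s (z.1, v))
      (fun v => G s (z.1, v)) z.2) :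
    ∀ᵐ z : Torus × Vel, |splitField γ q₀ F F s z - splitField γ q₀ G G s z| ≤
      4 * C * A * d * envelope q ϑ β s z.2 := by
  filter_upwards [h, ae_ae_uPost h, ae_ae_vPost h, ae_ae_fst h] with z h0 hu hv hl
  exact hK.abs_splitCollision_sub_le (collisionBound_envelope hq hβ hs) hA hd
    (measurable_slice hFm s z.1) (measurable_slice hGm s z.1) hu hv hl h0

theorem setIntegral_pow_div_factorial {L t : ℝ} (ht : 0 ≤ t) (n : ℕ) :
    ∫ s in Ioc 0 t, L * ((L * s) ^ n / n.factorial) = (L * t) ^ (n + 1) / (n + 1).factorial := by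
  rw [← intervalIntegral.integral_of_le ht]
  have h : (fun s : ℝ => L * ((L * s) ^ n / n.factorial)) =
      fun s => L ^ (n + 1) / n.factorial * s ^ n := by
    ext s; rw [mul_pow, pow_succ]; ring
  rw [h, intervalIntegral.integral_const_mul, integral_pow, Nat.factorial_succ, mul_pow]
  have hf : (n.factorial : ℝ) ≠ 0 := by positivity
  have hn : (n : ℝ) + 1 ≠ 0 := by positivity
  push_cast
  field_simp
  simp

/-- One step of the iteration: a bound for the difference of two mild solutions improves. -/
theorem KernelBound.ae_abs_sub_le_succ (hK : KernelBound γ q₀ C) (hq : 0 < q)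
    (hϑ : 0 ≤ ϑ) (hβ : 0 ≤ β) (hA : 0 ≤ A) (hd : 0 ≤ d)
    (hFm : Measurable fun p : ℝ × (Torus × Vel) => F p.1 p.2)
    (hGm : Measurable fun p : ℝ × (Torus × Vel) => G p.1 p.2)
    (hFA : ∀ t ∈ Icc 0 T, ∀ᵐ z, |F t z| ≤ A * envelope q ϑ β t z.2)
    (hGA : ∀ t ∈ Icc 0 T, ∀ᵐ z, |G t z| ≤ A * envelope q ϑ β t z.2)
    (hFi : ∀ t ∈ Icc 0 T, ∀ᵐ z : Torus × Vel,
      IntegrableOn (fun s => splitField γ q₀ F F s (backward z.1 (t - s) z.2, z.2)) (Ioc 0 t))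
    (hGi : ∀ t ∈ Icc 0 T, ∀ᵐ z : Torus × Vel,
      IntegrableOn (fun s => splitField γ q₀ G G s (backward z.1 (t - s) z.2, z.2)) (Ioc 0 t))
    (hFe : ∀ t ∈ Icc 0 T, ∀ᵐ z, F t z = duhamel γ q₀ F₀ F F t z)
    (hGe : ∀ t ∈ Icc 0 T, ∀ᵐ z, G t z = duhamel γ q₀ F₀ G G t z) (n : ℕ)
    (h : ∀ t ∈ Icc 0 T, ∀ᵐ z, |F t z - G t z| ≤
      d * ((4 * C * A * t) ^ n / n.factorial) * envelope q ϑ β t z.2) :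
    ∀ t ∈ Icc 0 T, ∀ᵐ z, |F t z - G t z| ≤
      d * ((4 * C * A * t) ^ (n + 1) / (n + 1).factorial) * envelope q ϑ β t z.2 := by
  intro t ht
  have hC := hK.constant_nonneg
  set L := 4 * C * A with hL
  have hL0 : 0 ≤ L := by positivity
  have h1 : ∀ s ∈ Ioc 0 t, ∀ᵐ z : Torus × Vel,
      |splitField γ q₀ F F s (backward z.1 (t - s) z.2, z.2) -
        splitField γ q₀ G G s (backward z.1 (t - s) z.2, z.2)| ≤
      L * ((L * s) ^ n / n.factorial) * (d * envelope q ϑ β t z.2) := fun s hs => by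
    have hs' : s ∈ Icc 0 T := ⟨hs.1.le, hs.2.trans ht.2⟩
    have hs0 : 0 ≤ s := hs'.1
    have hc : ∀ᵐ z : Torus × Vel, CloseAt (envelope q ϑ β s) A (d * ((L * s) ^ n / n.factorial))
        (fun v => F s (z.1, v)) (fun v => G s (z.1, v)) z.2 := by
      filter_upwards [hFA s hs', hGA s hs', h s hs'] with z a b c using ⟨a, b, c⟩
    have hb := hK.ae_abs_splitField_sub_le hq hβ hA (by positivity) hFm hGm hs0 hc
    filter_upwards [(measurePreserving_backward (t - s)).quasiMeasurePreserving.ae hb] with z hz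
    refine hz.trans ?_
    calc _ = L * ((L * s) ^ n / n.factorial) * (d * envelope q ϑ β s z.2) := by rw [hL]; ring
      _ ≤ _ := by
        have := envelope_mono (β := β) hq hϑ hs0 hs.2 z.2
        gcongr
  -- Measurability of this set allows Fubini to exchange "for every s, almost every z" for "for
  -- almost every z, almost every s".
  have hmeas : MeasurableSet {a : ℝ × (Torus × Vel) |
      |splitField γ q₀ F F a.1 (backward a.2.1 (t - a.1) a.2.2, a.2.2) -
        splitField γ q₀ G G a.1 (backward a.2.1 (t - a.1) a.2.2, a.2.2)| ≤
      L * ((L * a.1) ^ n / n.factorial) * (d * envelope q ϑ β t a.2.2)} := by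
    have e : Measurable fun a : ℝ × (Torus × Vel) => (((t, a.2), a.1) : (ℝ × (Torus × Vel)) × ℝ) := by
      fun_prop
    have m1 := (hK.measurable_characteristic_splitField hFm hFm).comp e
    have m2 := (hK.measurable_characteristic_splitField hGm hGm).comp e
    have m3 : Measurable fun a : ℝ × (Torus × Vel) => envelope q ϑ β t a.2.2 :=
      (measurable_envelope q ϑ β t).comp measurable_snd.snd
    have m4 : Measurable fun a : ℝ × (Torus × Vel) => L * ((L * a.1) ^ n / n.factorial) := by
      fun_prop
    exact measurableSet_le (continuous_abs.measurable.comp (m1.sub m2)) (m4.mul (m3.const_mul d))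
  have h2 : ∀ᵐ z : Torus × Vel, ∀ᵐ s ∂(volume.restrict (Ioc 0 t)),
      |splitField γ q₀ F F s (backward z.1 (t - s) z.2, z.2) -
        splitField γ q₀ G G s (backward z.1 (t - s) z.2, z.2)| ≤
      L * ((L * s) ^ n / n.factorial) * (d * envelope q ϑ β t z.2) :=
    (Measure.ae_ae_comm hmeas).1
      ((ae_restrict_iff' measurableSet_Ioc).2 (Eventually.of_forall h1))
  filter_upwards [h2, hFe t ht, hGe t ht, hFi t ht, hGi t ht] with z hz hF hG hFi hGi
  have hi : IntegrableOn (fun s => L * ((L * s) ^ n / n.factorial) * (d * envelope q ϑ β t z.2))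
      (Ioc 0 t) := by
    rw [← intervalIntegrable_iff_integrableOn_Ioc_of_le ht.1]
    exact Continuous.intervalIntegrable (by fun_prop) _ _
  rw [hF, hG]
  unfold duhamel
  rw [add_sub_add_left_eq_sub, ← integral_sub hFi hGi]
  refine (norm_integral_le_of_norm_le
    (f := fun s => splitField γ q₀ F F s (backward z.1 (t - s) z.2, z.2) -
      splitField γ q₀ G G s (backward z.1 (t - s) z.2, z.2)) hi hz).trans_eq ?_
  rw [integral_mul_const, setIntegral_pow_div_factorial ht.1]
  ring

/-- The crude bound 2A starts an iteration in which each time integration gains a factor in the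
factorial. No smallness of T relative to A is needed, so A may depend on the competitor. -/
theorem KernelBound.ae_eq_of_mild (hK : KernelBound γ q₀ C) (hq : 0 < q)
    (hϑ : 0 ≤ ϑ) (hβ : 0 ≤ β) (hA : 0 ≤ A)
    (hFm : Measurable fun p : ℝ × (Torus × Vel) => F p.1 p.2)
    (hGm : Measurable fun p : ℝ × (Torus × Vel) => G p.1 p.2)
    (hFA : ∀ t ∈ Icc 0 T, ∀ᵐ z, |F t z| ≤ A * envelope q ϑ β t z.2)
    (hGA : ∀ t ∈ Icc 0 T, ∀ᵐ z, |G t z| ≤ A * envelope q ϑ β t z.2)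
    (hFi : ∀ t ∈ Icc 0 T, ∀ᵐ z : Torus × Vel,
      IntegrableOn (fun s => splitField γ q₀ F F s (backward z.1 (t - s) z.2, z.2)) (Ioc 0 t))
    (hGi : ∀ t ∈ Icc 0 T, ∀ᵐ z : Torus × Vel,
      IntegrableOn (fun s => splitField γ q₀ G G s (backward z.1 (t - s) z.2, z.2)) (Ioc 0 t))
    (hFe : ∀ t ∈ Icc 0 T, ∀ᵐ z, F t z = duhamel γ q₀ F₀ F F t z)
    (hGe : ∀ t ∈ Icc 0 T, ∀ᵐ z, G t z = duhamel γ q₀ F₀ G G t z) :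
    ∀ t ∈ Icc 0 T, ∀ᵐ z, F t z = G t z := by
  have h : ∀ n : ℕ, ∀ t ∈ Icc 0 T, ∀ᵐ z, |F t z - G t z| ≤
      2 * A * ((4 * C * A * t) ^ n / n.factorial) * envelope q ϑ β t z.2 := fun n => by
    induction n with
    | zero =>
      intro t ht
      filter_upwards [hFA t ht, hGA t ht] with z h1 h2
      have := abs_sub (F t z) (G t z)
      simp only [pow_zero, Nat.factorial_zero, Nat.cast_one, div_one, mul_one]
      linarith
    | succ n ih =>
      exact hK.ae_abs_sub_le_succ hq hϑ hβ hA (by positivity) hFm hGm hFA hGA hFi hGi hFe hGe n ih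
  intro t ht
  filter_upwards [ae_all_iff.2 fun n => h n t ht] with z hz
  have hl : Tendsto (fun n : ℕ => 2 * A * ((4 * C * A * t) ^ n / n.factorial) *
      envelope q ϑ β t z.2) atTop (𝓝 0) := by
    simpa using ((FloorSemiring.tendsto_pow_div_factorial_atTop (4 * C * A * t)).const_mul
      (2 * A)).mul_const (envelope q ϑ β t z.2)
  have h0 := ge_of_tendsto' hl hz
  exact sub_eq_zero.1 (abs_eq_zero.1 (le_antisymm h0 (abs_nonneg _)))

/-! ### The perturbation around the Maxwellian -/

theorem perturbed_sub_maxwellian (f : Torus × Vel → ℝ) (z : Torus × Vel) (t : ℝ) :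
    |perturbed f z - maxwellian z.2| = |weighted q ϑ β t f z| * envelope q ϑ β t z.2 := by
  have hw := weight_pos q ϑ β t z.2
  unfold perturbed weighted envelope
  rw [add_sub_cancel_left, abs_mul, abs_mul, abs_of_nonneg (Real.sqrt_nonneg _), abs_of_pos hw]
  field_simp

theorem ae_abs_perturbed_sub_le {f : Torus × Vel → ℝ} {t M : ℝ} (hM : 0 ≤ M)
    (h : weightedNorm q ϑ β t f ≤ ENNReal.ofReal M) :
    ∀ᵐ z : Torus × Vel, |perturbed f z - maxwellian z.2| ≤ M * envelope q ϑ β t z.2 := by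
  unfold weightedNorm at h
  rw [eLpNorm_exponent_top] at h
  filter_upwards [ae_le_eLpNormEssSup (f := weighted q ϑ β t f) (μ := volume)] with z hz
  rw [perturbed_sub_maxwellian (q := q) (ϑ := ϑ) (β := β) f z t]
  refine mul_le_mul_of_nonneg_right ?_ (envelope_pos ..).le
  have h1 := hz.trans h
  rw [Real.enorm_eq_ofReal_abs] at h1
  exact (ENNReal.ofReal_le_ofReal_iff hM).1 h1

theorem weightedNorm_le {f : Torus × Vel → ℝ} {t M : ℝ}
    (h : ∀ z : Torus × Vel, |perturbed f z - maxwellian z.2| ≤ M * envelope q ϑ β t z.2) :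
    weightedNorm q ϑ β t f ≤ ENNReal.ofReal M := by
  unfold weightedNorm
  rw [eLpNorm_exponent_top]
  refine eLpNormEssSup_le_of_ae_bound (Eventually.of_forall fun z => ?_)
  have := h z
  rw [perturbed_sub_maxwellian (q := q) (ϑ := ϑ) (β := β) f z t] at this
  exact le_of_mul_le_mul_right this (envelope_pos ..)

/-- The function `f` with `μ + √μ f = F`. -/
noncomputable def fluctuation (F : Torus × Vel → ℝ) (z : Torus × Vel) : ℝ :=
  (F z - maxwellian z.2) / √(maxwellian z.2)

theorem perturbed_fluctuation (F : Torus × Vel → ℝ) : perturbed (fluctuation F) = F := by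
  ext z
  have := (Real.sqrt_pos.2 (maxwellian_pos z.2)).ne'
  unfold perturbed fluctuation
  field_simp
  ring

theorem perturbed_injective {f g : Torus × Vel → ℝ} {z : Torus × Vel}
    (h : perturbed f z = perturbed g z) : f z = g z :=
  mul_left_cancel₀ (Real.sqrt_pos.2 (maxwellian_pos z.2)).ne' (add_left_cancel h)

/-- Initial data have a version that is measurable and satisfies the bounds everywhere. -/
theorem exists_measurable_version {f₀ : Torus × Vel → ℝ}
    (hF₀ : ∀ᵐ z, 0 ≤ perturbed f₀ z) (hf₀ : MemLp (weighted q ϑ β 0 f₀) ∞ volume) :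
    ∃ H : Torus × Vel → ℝ, Measurable H ∧ (∀ z, 0 ≤ H z) ∧
      (∀ z, |H z - maxwellian z.2| ≤
        (weightedNorm q ϑ β 0 f₀).toReal * envelope q ϑ β 0 z.2) ∧
      perturbed f₀ =ᵐ[volume] H := by
  have htop : weightedNorm q ϑ β 0 f₀ ≠ ∞ := hf₀.2.ne
  have hw : Measurable fun z : Torus × Vel => weight q ϑ β 0 z.2 :=
    (measurable_weight q ϑ β 0).comp measurable_snd
  have hμ : Measurable fun z : Torus × Vel => maxwellian z.2 :=
    measurable_maxwellian.comp measurable_snd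
  have hρ : Measurable fun z : Torus × Vel => envelope q ϑ β 0 z.2 :=
    (measurable_envelope q ϑ β 0).comp measurable_snd
  have hm : AEMeasurable (perturbed f₀) := by
    have h1 : AEMeasurable fun z : Torus × Vel =>
        maxwellian z.2 + envelope q ϑ β 0 z.2 * weighted q ϑ β 0 f₀ z :=
      hμ.aemeasurable.add (hρ.aemeasurable.mul hf₀.1.aemeasurable)
    refine h1.congr (Eventually.of_forall fun z => ?_)
    have := (weight_pos q ϑ β 0 z.2).ne'
    simp only [perturbed, weighted, envelope]
    field_simp
  let H₁ := hm.mk (perturbed f₀)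
  have hH₁ : Measurable H₁ := hm.measurable_mk
  -- Off this set of full measure the data are replaced by μ, which satisfies both conditions.
  let S : Set (Torus × Vel) := {z | 0 ≤ H₁ z} ∩ {z | |H₁ z - maxwellian z.2| ≤
    (weightedNorm q ϑ β 0 f₀).toReal * envelope q ϑ β 0 z.2}
  have hS : MeasurableSet S := (measurableSet_le measurable_const hH₁).inter
    (measurableSet_le (continuous_abs.measurable.comp (hH₁.sub hμ)) (hρ.const_mul _))
  classical
  refine ⟨S.piecewise H₁ fun z => maxwellian z.2, hH₁.piecewise hS hμ, fun z => ?_, fun z => ?_, ?_⟩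
  · by_cases hz : z ∈ S
    · simpa [hz] using hz.1
    · simpa [hz] using (maxwellian_pos z.2).le
  · by_cases hz : z ∈ S
    · simpa [hz] using hz.2
    · simpa [hz] using mul_nonneg ENNReal.toReal_nonneg (envelope_pos ..).le
  · filter_upwards [hm.ae_eq_mk, hF₀, ae_abs_perturbed_sub_le (t := 0) ENNReal.toReal_nonneg
      (ENNReal.ofReal_toReal htop).ge] with z h1 h2 h3
    have hz : z ∈ S := by
      rw [h1] at h2 h3
      exact ⟨h2, h3⟩
    simpa [hz] using h1

end

/-! ### Mild solutions and the Duhamel equation -/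

section

variable {γ : ℝ} {q₀ : ℝ → ℝ} {C q ϑ β T A : ℝ} {F G : ℝ → Torus × Vel → ℝ}
  {F₀ : Torus × Vel → ℝ}

theorem IsMildSolution.ae_eq_duhamel (h : IsMildSolution γ q₀ F₀ T F) :
    ∀ t ∈ Icc 0 T, ∀ᵐ z, F t z = duhamel γ q₀ F₀ F F t z := fun t ht => by
  filter_upwards [h.equation t ht] with z hz
  rw [hz, intervalIntegral.integral_of_le ht.1]
  rfl

theorem IsMildSolution.ae_integrableOn (h : IsMildSolution γ q₀ F₀ T F) :
    ∀ t ∈ Icc 0 T, ∀ᵐ z : Torus × Vel,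
      IntegrableOn (fun s => splitField γ q₀ F F s (backward z.1 (t - s) z.2, z.2)) (Ioc 0 t) :=
  fun t ht => by
    filter_upwards [h.integrable_collision t ht] with z hz
    exact (intervalIntegrable_iff_integrableOn_Ioc_of_le ht.1).1 hz

/-- A measurable extension of a mild solution to all times. -/
theorem IsMildSolution.exists_extension (hT : 0 ≤ T) (h : IsMildSolution γ q₀ F₀ T F) :
    ∃ G : ℝ → Torus × Vel → ℝ, (Measurable fun p : ℝ × (Torus × Vel) => G p.1 p.2) ∧
      (∀ t ∈ Icc 0 T, G t = F t) ∧
      (∀ t ∈ Icc 0 T, ∀ᵐ z : Torus × Vel, IntegrableOn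
        (fun s => splitField γ q₀ G G s (backward z.1 (t - s) z.2, z.2)) (Ioc 0 t)) ∧
      ∀ t ∈ Icc 0 T, ∀ᵐ z, G t z = duhamel γ q₀ F₀ G G t z := by
  -- Clamping time to [0, T] keeps measurability and changes nothing inside the interval.
  let G : ℝ → Torus × Vel → ℝ := fun s => F (projIcc 0 T hT s)
  have hG : ∀ t ∈ Icc 0 T, G t = F t := fun t ht => by simp only [G, projIcc_of_mem hT ht]
  have hs : ∀ t ∈ Icc 0 T, ∀ s ∈ Ioc 0 t, ∀ z,
      splitField γ q₀ F F s z = splitField γ q₀ G G s z := fun t ht s hs z => by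
    simp only [splitField, hG s ⟨hs.1.le, hs.2.trans ht.2⟩]
  refine ⟨G, ?_, hG, fun t ht => ?_, fun t ht => ?_⟩
  · have e : Measurable fun p : ℝ × (Torus × Vel) => (projIcc 0 T hT p.1, p.2) :=
      (continuous_projIcc.measurable.comp measurable_fst).prodMk measurable_snd
    exact h.measurable.comp e
  · filter_upwards [h.ae_integrableOn t ht] with z hz
    exact hz.congr_fun (fun s hs' => hs t ht s hs' _) measurableSet_Ioc
  · filter_upwards [h.ae_eq_duhamel t ht] with z hz
    rw [hG t ht, hz]
    exact congrArg _ (setIntegral_congr_fun measurableSet_Ioc fun s hs' => hs t ht s hs' _)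

theorem KernelBound.isNonnegSolution (hK : KernelBound γ q₀ C) (hq : 0 < q)
    (hϑ : 0 ≤ ϑ) (hβ : 0 ≤ β) (hA : 0 ≤ A) {H : Torus × Vel → ℝ} (hH : F₀ =ᵐ[volume] H)
    (hFm : Measurable fun p : ℝ × (Torus × Vel) => F p.1 p.2)
    (hF : CloseOn q ϑ β T A A F (fun _ _ => 0)) (hnn : ∀ t ∈ Icc 0 T, ∀ z, 0 ≤ F t z)
    (heq : ∀ t ∈ Icc 0 T, ∀ z, F t z = duhamel γ q₀ H F F t z) :
    IsNonnegSolution γ q₀ F₀ T F where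
  measurable := hFm.comp
    ((measurable_subtype_coe.comp measurable_fst).prodMk measurable_snd)
  integrable_gain t ht := Eventually.of_forall fun z =>
    hK.integrable_gainIntegrand (collisionBound_envelope hq hβ ht.1) hA
      (measurable_slice hFm t z.1) (measurable_slice hFm t z.1)
      (Eventually.of_forall fun _ => (hF t ht z.1 _).1)
      (Eventually.of_forall fun _ => (hF t ht z.1 _).1)
  integrable_loss t ht := Eventually.of_forall fun z =>
    hK.integrable_lossIntegrand (collisionBound_envelope hq hβ ht.1) hA
      (measurable_slice hFm t z.1) (Eventually.of_forall fun _ => (hF t ht z.1 _).1)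
      (hF t ht z.1 _).1
  integrable_collision t ht := Eventually.of_forall fun z =>
    (intervalIntegrable_iff_integrableOn_Ioc_of_le ht.1).2
      (hK.integrableOn_splitField hq hϑ hβ hA hFm hFm hF hF ht z)
  equation t ht := by
    -- Transport preserves null sets, so the data may replace their version H at the foot of almost
    -- every characteristic.
    filter_upwards [(measurePreserving_backward t).quasiMeasurePreserving.ae hH] with z hz
    rw [heq t ht z, hz, intervalIntegral.integral_of_le ht.1]
    rfl
  nonneg t ht := Eventually.of_forall (hnn t ht)

end

end Boltzmann

/-! ### Existence, bound and uniqueness for the perturbation -/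

theorem lemmaA1 (γ : ℝ) (hγ : -3 < γ) (hγ' : γ < 0)
    (q₀ : ℝ → ℝ) (hq₀_meas : Measurable q₀)
    (hq₀ : ∃ C : ℝ, ∀ θ ∈ Icc (0 : ℝ) Real.pi, 0 ≤ q₀ θ ∧ q₀ θ ≤ C * |Real.cos θ|)
    (q ϑ β : ℝ) (hq : 0 < q) (hq' : q < 1) (hϑ : 0 ≤ ϑ) (hϑ' : ϑ < -2 / γ) (hβ : 7 / 2 ≤ β)
    (f₀ : Boltzmann.Torus × Boltzmann.Vel → ℝ)
    (hF₀ : ∀ᵐ z : Boltzmann.Torus × Boltzmann.Vel, 0 ≤ Boltzmann.perturbed f₀ z)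
    (hf₀ : MemLp (Boltzmann.weighted q ϑ β 0 f₀) ∞ volume) :
    ∃ T : ℝ, 0 < T ∧ ∃ f : ℝ → Boltzmann.Torus × Boltzmann.Vel → ℝ,
      Boltzmann.IsNonnegSolution γ q₀ (Boltzmann.perturbed f₀) T
        (fun t => Boltzmann.perturbed (f t)) ∧
      (⨆ t ∈ Icc (0 : ℝ) T, Boltzmann.weightedNorm q ϑ β t (f t)) ≤
        2 * Boltzmann.weightedNorm q ϑ β 0 f₀ ∧
      ∀ g : ℝ → Boltzmann.Torus × Boltzmann.Vel → ℝ,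
        Boltzmann.IsNonnegSolution γ q₀ (Boltzmann.perturbed f₀) T
          (fun t => Boltzmann.perturbed (g t)) →
        (⨆ t ∈ Icc (0 : ℝ) T, Boltzmann.weightedNorm q ϑ β t (g t)) < ∞ →
        ∀ t ∈ Icc (0 : ℝ) T, ∀ᵐ z : Boltzmann.Torus × Boltzmann.Vel, g t z = f t z := by
  obtain ⟨C, hK⟩ := Boltzmann.exists_kernelBound hγ hγ' hq₀_meas hq₀
  have hβ0 : 0 < β := by linarith
  obtain ⟨D, hD0, hD⟩ := Boltzmann.exists_maxwellian_le hq hq' hϑ hβ0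
  obtain ⟨H, hHm, hHnn, hHM, hH⟩ := Boltzmann.exists_measurable_version hF₀ hf₀
  have htop : Boltzmann.weightedNorm q ϑ β 0 f₀ ≠ ∞ := hf₀.2.ne
  set M := (Boltzmann.weightedNorm q ϑ β 0 f₀).toReal with hM
  have hM0 : 0 ≤ M := ENNReal.toReal_nonneg
  obtain ⟨T, hT, F, hFm, hFM, hFnn, heq⟩ :=
    hK.exists_solution hq hϑ hβ0.le hD0 hD hHm hHnn hM0 hHM
  -- The radius N is left free: 2M serves for existence, and 2M plus the competitor's norm gives a
  -- common bound for uniqueness.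
  have hclose : ∀ N, 2 * M ≤ N → Boltzmann.CloseOn q ϑ β T (D + N) (D + N) F (fun _ _ => 0) :=
    fun N hN => by
      have hFN : ∀ t ∈ Icc 0 T, ∀ z : Boltzmann.Torus × Boltzmann.Vel,
          |F t z - Boltzmann.maxwellian z.2| ≤ N * Boltzmann.envelope q ϑ β t z.2 := fun t ht z =>
        (hFM t ht z).trans (mul_le_mul_of_nonneg_right hN (Boltzmann.envelope_pos ..).le)
      exact (Boltzmann.closeOn_of_abs_sub_maxwellian_le hD hFN hFN (d := 0) (by simp)).zero_right
        (by linarith)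
  have hsol : Boltzmann.IsNonnegSolution γ q₀ (Boltzmann.perturbed f₀) T F :=
    hK.isNonnegSolution hq hϑ hβ0.le (by linarith) hH hFm (hclose _ le_rfl) hFnn heq
  refine ⟨T, hT, fun t => Boltzmann.fluctuation (F t), ?_, iSup₂_le fun t ht => ?_,
    fun g hg hgN t ht => ?_⟩
  · simpa only [Boltzmann.perturbed_fluctuation] using hsol
  · refine (Boltzmann.weightedNorm_le (M := 2 * M) fun z => ?_).trans_eq ?_
    · rw [Boltzmann.perturbed_fluctuation]
      exact hFM t ht z
    · rw [ENNReal.ofReal_mul zero_le_two, hM, ENNReal.ofReal_toReal htop, ENNReal.ofReal_ofNat]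
  · set N := (⨆ t ∈ Icc (0 : ℝ) T, Boltzmann.weightedNorm q ϑ β t (g t)).toReal with hN
    have hN0 : 0 ≤ N := ENNReal.toReal_nonneg
    obtain ⟨G, hGm, hGg, hGi, hGe⟩ := hg.toIsMildSolution.exists_extension hT.le
    have hGA : ∀ t ∈ Icc 0 T, ∀ᵐ z : Boltzmann.Torus × Boltzmann.Vel,
        |G t z| ≤ (D + (2 * M + N)) * Boltzmann.envelope q ϑ β t z.2 := fun t ht => by
      have hle : Boltzmann.weightedNorm q ϑ β t (g t) ≤ ENNReal.ofReal N := by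
        rw [hN, ENNReal.ofReal_toReal hgN.ne]
        exact le_iSup₂ (f := fun t (_ : t ∈ Icc (0 : ℝ) T) =>
          Boltzmann.weightedNorm q ϑ β t (g t)) t ht
      filter_upwards [Boltzmann.ae_abs_perturbed_sub_le hN0 hle] with z hz
      have h1 := abs_le.1 hz
      have h2 := hD t ht.1 z.2
      have h3 := Boltzmann.maxwellian_pos z.2
      have h4 := mul_nonneg hM0 (Boltzmann.envelope_pos q ϑ β t z.2).le
      rw [hGg t ht, abs_le]
      constructor <;> linarith [h1.1, h1.2]
    have hFA : ∀ t ∈ Icc 0 T, ∀ᵐ z : Boltzmann.Torus × Boltzmann.Vel,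
        |F t z| ≤ (D + (2 * M + N)) * Boltzmann.envelope q ϑ β t z.2 := fun t ht =>
      Filter.Eventually.of_forall fun z => (hclose (2 * M + N) (by linarith) t ht z.1 z.2).1
    filter_upwards [hK.ae_eq_of_mild hq hϑ hβ0.le (by linarith) hFm hGm hFA hGA
      hsol.toIsMildSolution.ae_integrableOn hGi hsol.toIsMildSolution.ae_eq_duhamel hGe t ht]
      with z hz
    refine Boltzmann.perturbed_injective ?_
    rw [Boltzmann.perturbed_fluctuation, hz, hGg t ht]
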